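/- **Theorem.** Let $k\ge 2$. Put $P_k=\pi_{2k-1}(SO)$, so that by Bott periodicity $P_k=\mathbb Z,\ \mathbb Z/2,\ \mathbb Z,\ 0$ for $k\equiv 0,1,2,3 \pmod 4$ respectively. *Forms.* An extended quadratic form over $\pi_{2k-1}\{SO(2k)\}$ is a triple $(H,\lambda,\alpha)$, where $H$ is a finitely generated free abelian group, $\lambda\colon H\times H\to\mathbb Z$ is a symmetric bilinear form and $\alpha\colon H\to P_k$ is a homomorphism, such that $\lambda(x,x)\equiv\alpha(x) \pmod 2$ for all $x\in H$ if $k=2,4$, and $\lambda(x,x)$ is even for all $x\in H$ if $k\ne 2,4$. It is nondegenerate if the adjoint $\widehat\lambda\colon H\to H^*=\mathrm{Hom}(H,\mathbb Z)$, $\widehat\lambda(x)=\lambda(x,\cdot)$, is injective. It is treelike if $H$ has a basis $v_1,\dots,v_r$, in bijection with the vertices of a tree whose vertices carry integer labels $a_1,\dots,a_r$, such that $\lambda(v_i,v_i)=a_i$ and, for $i\neq j$, $\lambda(v_i,v_j)=1$ if the vertices $i$ and $j$ are joined by an edge and $\lambda(v_i,v_j)=0$ otherwise. *Linking forms.* An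 extended quadratic linking form over $\pi_{2k-1}\{SO(2k)\}$ is a quadruple $(G,b,q,\beta)$, where $G$ is a finite abelian group, $b\colon G\times G\to\mathbb Q/\mathbb Z$ is a symmetric bilinear form such that $b(x,\cdot)=0$ only for $x=0$, $q\colon G\to\mathbb Q/\mathbb Z$ is a function with $q(x+y)-q(x)-q(y)=b(x,y)$, and $\beta\in G\otimes P_k$, such that - if $k=2,4$, then $\beta\in (2\cdot G)\otimes P_k= 2\cdot G$ and $q(x)-q(-x)=b(x,\beta)$ for all $x\in G$; - if $k\neq 2,4$, then $q(-x)=q(x)$ for all $x\in G$. An isomorphism of such quadruples is an isomorphism of groups that carries $b$, $q$ and $\beta$ to each other. *Boundary.* Let $(H,\lambda,\alpha)$ be nondegenerate, let $\lambda^{-1}\colon H^*\times H^*\to\mathbb Q$ be the form induced by the rational extension of $\lambda$ through the inverse of $\widehat\lambda\otimes\mathbb Q$, let $G=\mathrm{coker}(\widehat\lambda)$ and let $\pi\colon H^*\to G$ be the projection. The boundary $\partial(H,\lambda,\alpha)$ is the extended quadratic linking form $(G,b,q,\beta)$ with $$b(\pi(x),\pi(y))=\lambda^{-1}(x,y)\bmod\mathbb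 Z,$$ $$q(\pi(x))=\tfrac12\bigl(\lambda^{-1}(x,x)+\lambda^{-1}(x,\alpha)\bigr)\bmod\mathbb Z\ \text{ if } k=2,4,\qquad q(\pi(x))=\tfrac12\lambda^{-1}(x,x)\bmod\mathbb Z\ \text{ if } k\neq 2,4,$$ and $\beta=(\pi\otimes\mathrm{id})(\alpha)\in G\otimes P_k$, where $\alpha\in\mathrm{Hom}(H,P_k)=H^*\otimes P_k$. *Claim.* The boundary map from isomorphism classes of nondegenerate treelike extended quadratic forms to isomorphism classes of extended quadratic linking forms is onto: for every extended quadratic linking form $(G,b,q,\beta)$ over $\pi_{2k-1}\{SO(2k)\}$ there is a nondegenerate treelike extended quadratic form $(H,\lambda,\alpha)$ over $\pi_{2k-1}\{SO(2k)\}$ such that $(G,b,q,\beta)$ is isomorphic to $\partial(H,\lambda,\alpha)$. -/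

import Mathlib

open scoped TensorProduct

set_option linter.unusedSectionVars false

noncomputable section

/-! ### The stable group and extended quadratic forms -/

/-- The number `m` such that `π_{2k-1}(SO) ≅ ℤ/m`, by Bott periodicity: the group is
`ℤ, ℤ/2, ℤ, 0` for `k ≡ 0, 1, 2, 3` modulo `4`. -/
def bottModulus (k : ℕ) : ℕ :=
  if k % 4 = 0 ∨ k % 4 = 2 then 0 else if k % 4 = 1 then 2 else 1

/-- The stable homotopy group `π_{2k-1}(SO)` with the identification of Bott periodicity
(recall that `ZMod 0 = ℤ`, and that `ZMod 1` is trivial). -/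
abbrev StableGroup (k : ℕ) : Type := ZMod (bottModulus k)

/-- The exceptional dimensions, in which the stable class is characteristic for the form. -/
def IsExceptional (k : ℕ) : Prop := k = 2 ∨ k = 4

theorem IsExceptional.bottModulus_eq {k : ℕ} (h : IsExceptional k) : bottModulus k = 0 := by
  rcases h with rfl | rfl <;> rfl

/-- The identification `π_{2k-1}(SO) = ℤ` for `k = 2, 4`. -/
def stableGroupInt {k : ℕ} (h : IsExceptional k) : StableGroup k ≃+* ℤ :=
  ZMod.ringEquivCongr h.bottModulus_eq

/-- An extended quadratic form `(H, λ, α)` over `π_{2k-1}{SO(2k)}`. It is used for `H` a finitely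
generated free abelian group. -/
structure ExtendedQuadraticForm (k : ℕ) (H : Type*) [AddCommGroup H] where
  /-- The bilinear form; as a map `H → Hom(H, ℤ)` it is its own adjoint homomorphism. -/
  form : H →ₗ[ℤ] H →ₗ[ℤ] ℤ
  form_symm : ∀ x y, form x y = form y x
  /-- The stable class. -/
  stable : H →ₗ[ℤ] StableGroup k
  characteristic : ∀ h : IsExceptional k, ∀ x,
    form x x ≡ stableGroupInt h (stable x) [ZMOD 2]
  even : ¬ IsExceptional k → ∀ x, Even (form x x)

/-! ### Extended quadratic linking forms -/

/-- An extended quadratic linking form `(G, b, q, β)` over `π_{2k-1}{SO(2k)}`. The group `ℚ/ℤ` is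
`AddCircle (1 : ℚ)`. -/
structure ExtendedQuadraticLinkingForm (k : ℕ) (G : Type*) [AddCommGroup G] where
  finite : Finite G
  b : G →+ G →+ AddCircle (1 : ℚ)
  b_symm : ∀ x y, b x y = b y x
  b_nonsingular : ∀ x, (∀ y, b x y = 0) → x = 0
  q : G → AddCircle (1 : ℚ)
  q_refines : ∀ x y, q (x + y) - q x - q y = b x y
  β : G ⊗[ℤ] StableGroup k
  /-- For `k = 2, 4` the group `G ⊗ π_{2k-1}(SO)` is `G`; the element `β` lies in `2 • G` and is
  the homogeneity defect of `q`. -/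
  defect : IsExceptional k → ∃ g : G, β = (2 • g) ⊗ₜ[ℤ] (1 : StableGroup k) ∧
    ∀ x, q x - q (-x) = b x (2 • g)
  homogeneous : ¬ IsExceptional k → ∀ x, q x = q (-x)

/-- Isomorphism of extended quadratic linking forms. -/
def ExtendedQuadraticLinkingForm.Isomorphic {k : ℕ} {G₁ G₂ : Type*} [AddCommGroup G₁]
    [AddCommGroup G₂] (Q₁ : ExtendedQuadraticLinkingForm k G₁)
    (Q₂ : ExtendedQuadraticLinkingForm k G₂) : Prop :=
  ∃ e : G₁ ≃+ G₂, (∀ x y, Q₂.b (e x) (e y) = Q₁.b x y) ∧ (∀ x, Q₂.q (e x) = Q₁.q x) ∧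
    LinearMap.rTensor (StableGroup k) e.toIntLinearEquiv.toLinearMap Q₁.β = Q₂.β

/-! ### Treelike forms -/

/-- A `ℤ`-labelled tree with vertices `v_1, …, v_r`. -/
structure LabelledTree (r : ℕ) where
  graph : SimpleGraph (Fin r)
  isTree : graph.IsTree
  label : Fin r → ℤ

open Classical in
/-- The matrix of the form of a labelled tree in the basis of vertices. -/
def LabelledTree.matrix {r : ℕ} (t : LabelledTree r) : Matrix (Fin r) (Fin r) ℤ :=
  Matrix.of fun i j => if i = j then t.label i else if t.graph.Adj i j then 1 else 0

/-- The symmetric bilinear form `λ_t` on the free abelian group on the vertices. -/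
def LabelledTree.form {r : ℕ} (t : LabelledTree r) :
    (Fin r → ℤ) →ₗ[ℤ] (Fin r → ℤ) →ₗ[ℤ] ℤ :=
  Matrix.toLinearMap₂' ℤ t.matrix

namespace ExtendedQuadraticForm

/-- `(H, λ, α)` is treelike if `(H, λ)` is isomorphic to the form of a labelled tree. -/
def IsTreelike {k : ℕ} {H : Type*} [AddCommGroup H] (F : ExtendedQuadraticForm k H) : Prop :=
  ∃ (r : ℕ) (t : LabelledTree r) (e : H ≃ₗ[ℤ] (Fin r → ℤ)),
    ∀ x y, t.form (e x) (e y) = F.form x y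

/-- `(H, λ, α)` is nondegenerate if the adjoint homomorphism of `λ` is injective. -/
def IsNondegenerate {k : ℕ} {H : Type*} [AddCommGroup H] (F : ExtendedQuadraticForm k H) : Prop :=
  Function.Injective F.form

/-! ### The algebraic boundary -/

variable {k : ℕ} {H : Type*} [AddCommGroup H] [Module.Free ℤ H] [Module.Finite ℤ H]

/-- The cokernel `G` of the adjoint homomorphism `H → H^*`. -/
abbrev Coker (F : ExtendedQuadraticForm k H) : Type _ :=
  Module.Dual ℤ H ⧸ LinearMap.range F.form

/-- The rational extension of `λ` to `ℚ ⊗ H`. -/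
def ratForm (F : ExtendedQuadraticForm k H) : LinearMap.BilinForm ℚ (ℚ ⊗[ℤ] H) :=
  LinearMap.BilinForm.baseChange ℚ F.form

theorem ratForm_tmul (F : ExtendedQuadraticForm k H) (a b : ℚ) (x y : H) :
    F.ratForm (a ⊗ₜ x) (b ⊗ₜ y) = F.form x y * (a * b) := by
  simp [ratForm, LinearMap.BilinForm.baseChange_tmul]

theorem ratForm_symm (F : ExtendedQuadraticForm k H) (z w : ℚ ⊗[ℤ] H) :
    F.ratForm z w = F.ratForm w z := by
  induction z using TensorProduct.induction_on with
  | zero => simp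
  | add z₁ z₂ h₁ h₂ => simp [h₁, h₂]
  | tmul a x =>
    induction w using TensorProduct.induction_on with
    | zero => simp
    | add w₁ w₂ h₁ h₂ => simp [h₁, h₂]
    | tmul b y => rw [ratForm_tmul, ratForm_tmul, F.form_symm, mul_comm a b]

theorem exists_smul_eq_tmul (z : ℚ ⊗[ℤ] H) :
    ∃ n : ℤ, n ≠ 0 ∧ ∃ h : H, (n : ℚ) • z = (1 : ℚ) ⊗ₜ[ℤ] h := by
  induction z using TensorProduct.induction_on with
  | zero => exact ⟨1, one_ne_zero, 0, by simp⟩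
  | tmul a x =>
    refine ⟨a.den, by exact_mod_cast a.den_ne_zero, a.num • x, ?_⟩
    rw [TensorProduct.smul_tmul', TensorProduct.tmul_smul, TensorProduct.smul_tmul']
    congr 1
    simp
  | add z w hz hw =>
    obtain ⟨n, hn, h, e⟩ := hz
    obtain ⟨m, hm, h', e'⟩ := hw
    refine ⟨n * m, mul_ne_zero hn hm, m • h + n • h', ?_⟩
    rw [TensorProduct.tmul_add, TensorProduct.tmul_smul, TensorProduct.tmul_smul, ← e, ← e',
      smul_add]
    push_cast
    rw [← Int.cast_smul_eq_zsmul ℚ, ← Int.cast_smul_eq_zsmul ℚ, smul_smul, smul_smul,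
      mul_comm (m : ℚ)]

theorem ratForm_nondegenerate (F : ExtendedQuadraticForm k H) (hF : F.IsNondegenerate) :
    F.ratForm.Nondegenerate := by
  have key : ∀ z, (∀ w, F.ratForm z w = 0) → z = 0 := by
    intro z hz
    obtain ⟨n, hn, h, e⟩ := exists_smul_eq_tmul z
    have hn' : (n : ℚ) ≠ 0 := by exact_mod_cast hn
    have h0 : h = 0 := by
      apply hF
      ext y
      have h1 := ratForm_tmul F 1 1 h y
      rw [← e] at h1
      simp only [map_smul, LinearMap.smul_apply, hz] at h1
      simpa using h1.symm
    rw [h0, TensorProduct.tmul_zero] at e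
    exact (smul_eq_zero.mp e).resolve_left hn'
  exact ⟨key, fun z hz => key z fun w => by rw [ratForm_symm]; exact hz w⟩

/-- The form `λ⁻¹` on `H^*`: the pullback of the rational extension of `λ` under the inverse of its
adjoint isomorphism `ℚ ⊗ H → (ℚ ⊗ H)^* = ℚ ⊗ H^*`. -/
def inverseForm (F : ExtendedQuadraticForm k H) (hF : F.IsNondegenerate)
    (x y : Module.Dual ℤ H) : ℚ :=
  let adj := LinearMap.BilinForm.toDual F.ratForm (F.ratForm_nondegenerate hF)
  F.ratForm (adj.symm (Module.Dual.baseChange ℚ x)) (adj.symm (Module.Dual.baseChange ℚ y))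

theorem inverseForm_symm (F : ExtendedQuadraticForm k H) (hF : F.IsNondegenerate)
    (x y : Module.Dual ℤ H) : F.inverseForm hF x y = F.inverseForm hF y x :=
  F.ratForm_symm _ _

theorem inverseForm_add_left (F : ExtendedQuadraticForm k H) (hF : F.IsNondegenerate)
    (x x' y : Module.Dual ℤ H) :
    F.inverseForm hF (x + x') y = F.inverseForm hF x y + F.inverseForm hF x' y := by
  simp [inverseForm]

theorem inverseForm_add_right (F : ExtendedQuadraticForm k H) (hF : F.IsNondegenerate)
    (x y y' : Module.Dual ℤ H) :
    F.inverseForm hF x (y + y') = F.inverseForm hF x y + F.inverseForm hF x y' := by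
  simp [inverseForm]

/-- `λ⁻¹(λ(h, ·), y) = y(h)`. -/
theorem inverseForm_form (F : ExtendedQuadraticForm k H) (hF : F.IsNondegenerate)
    (h : H) (y : Module.Dual ℤ H) : F.inverseForm hF (F.form h) y = y h := by
  have e : (LinearMap.BilinForm.toDual F.ratForm (F.ratForm_nondegenerate hF)).symm
      (Module.Dual.baseChange ℚ (F.form h)) = (1 : ℚ) ⊗ₜ[ℤ] h := by
    rw [LinearEquiv.symm_apply_eq]
    ext w
    simp [LinearMap.BilinForm.toDual_def, ratForm_tmul]
  rw [inverseForm_symm]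
  simp only [inverseForm]
  rw [e, LinearMap.BilinForm.apply_toDual_symm_apply]
  simp

theorem finite_coker (F : ExtendedQuadraticForm k H) (hF : F.IsNondegenerate) :
    Finite F.Coker := by
  apply Submodule.finiteQuotientOfFreeOfRankEq
  rw [LinearMap.finrank_range_of_inj hF]
  exact (LinearEquiv.finrank_eq (Module.Free.chooseBasis ℤ H).toDualEquiv)

/-- The stable class as an element of `H^*`, for `k = 2, 4`. -/
def stableDual (F : ExtendedQuadraticForm k H) (h : IsExceptional k) : Module.Dual ℤ H :=
  ((stableGroupInt h).toAddMonoidHom.comp F.stable.toAddMonoidHom).toIntLinearMap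

theorem stableDual_apply (F : ExtendedQuadraticForm k H) (h : IsExceptional k) (x : H) :
    F.stableDual h x = stableGroupInt h (F.stable x) := rfl

/-- The linking form of the boundary on representatives: `λ⁻¹(x, y)` modulo `ℤ`. -/
def linking (F : ExtendedQuadraticForm k H) (hF : F.IsNondegenerate) :
    Module.Dual ℤ H →+ Module.Dual ℤ H →+ AddCircle (1 : ℚ) :=
  AddMonoidHom.mk' (fun x => AddMonoidHom.mk'
      (fun y => ((F.inverseForm hF x y : ℚ) : AddCircle (1 : ℚ)))
      fun y y' => by rw [inverseForm_add_right]; rfl)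
    fun x x' => by ext y; exact congrArg _ (F.inverseForm_add_left hF x x' y)

theorem linking_apply (F : ExtendedQuadraticForm k H) (hF : F.IsNondegenerate)
    (x y : Module.Dual ℤ H) :
    F.linking hF x y = ((F.inverseForm hF x y : ℚ) : AddCircle (1 : ℚ)) := rfl

open Classical in
/-- The quadratic refinement of the boundary on representatives: `(λ⁻¹(x, x) + λ⁻¹(x, α)) / 2`
modulo `ℤ` if `k = 2, 4`, and `λ⁻¹(x, x) / 2` modulo `ℤ` otherwise. -/
def refinement (F : ExtendedQuadraticForm k H) (hF : F.IsNondegenerate)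
    (x : Module.Dual ℤ H) : AddCircle (1 : ℚ) :=
  if h : IsExceptional k then
    (((F.inverseForm hF x x + F.inverseForm hF x (F.stableDual h)) / 2 : ℚ) : AddCircle (1 : ℚ))
  else ((F.inverseForm hF x x / 2 : ℚ) : AddCircle (1 : ℚ))

theorem inverseForm_zero_right (F : ExtendedQuadraticForm k H) (hF : F.IsNondegenerate)
    (x : Module.Dual ℤ H) : F.inverseForm hF x 0 = 0 := by
  simp [inverseForm]

theorem inverseForm_neg_left (F : ExtendedQuadraticForm k H) (hF : F.IsNondegenerate)
    (x y : Module.Dual ℤ H) : F.inverseForm hF (-x) y = -F.inverseForm hF x y := by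
  simp [inverseForm]

theorem inverseForm_nsmul_left (F : ExtendedQuadraticForm k H) (hF : F.IsNondegenerate)
    (n : ℕ) (x y : Module.Dual ℤ H) :
    F.inverseForm hF (n • x) y = n * F.inverseForm hF x y := by
  induction n with
  | zero => simp [inverseForm]
  | succ n ih => rw [succ_nsmul, inverseForm_add_left, ih]; push_cast; ring

theorem coe_int_eq_zero (n : ℤ) : (((n : ℚ)) : AddCircle (1 : ℚ)) = 0 :=
  (AddCircle.coe_eq_zero_iff (1 : ℚ)).2 ⟨n, by simp⟩

theorem exists_characteristic (F : ExtendedQuadraticForm k H) (hF : F.IsNondegenerate) :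
    ∃ c : Module.Dual ℤ H, (∀ x, Even (F.form x x + c x)) ∧
      (∀ h : IsExceptional k, c = F.stableDual h) ∧ (¬ IsExceptional k → c = 0) ∧
      ∀ x, F.refinement hF x =
        (((F.inverseForm hF x x + F.inverseForm hF x c) / 2 : ℚ) : AddCircle (1 : ℚ)) := by
  by_cases h : IsExceptional k
  · refine ⟨F.stableDual h, fun x => ?_, fun _ => rfl, fun h' => absurd h h',
      fun x => by simp [refinement, h]⟩
    have := F.characteristic h x
    rw [← stableDual_apply] at this
    rw [Int.even_iff]
    rw [Int.ModEq] at this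
    omega
  · refine ⟨0, fun x => by simpa using F.even h x, fun h' => absurd h' h, fun _ => rfl,
      fun x => by simp [refinement, h, inverseForm_zero_right]⟩

theorem refinement_add (F : ExtendedQuadraticForm k H) (hF : F.IsNondegenerate)
    (x y : Module.Dual ℤ H) :
    F.refinement hF (x + y) - F.refinement hF x - F.refinement hF y = F.linking hF x y := by
  obtain ⟨c, -, -, -, hc⟩ := F.exists_characteristic hF
  rw [hc, hc, hc]
  rw [linking_apply, ← AddCircle.coe_sub, ← AddCircle.coe_sub]
  congr 1
  simp only [inverseForm_add_left, inverseForm_add_right]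
  rw [F.inverseForm_symm hF y x]
  ring

theorem linking_symm (F : ExtendedQuadraticForm k H) (hF : F.IsNondegenerate)
    (x y : Module.Dual ℤ H) : F.linking hF x y = F.linking hF y x := by
  rw [linking_apply, linking_apply, inverseForm_symm]

theorem linking_form (F : ExtendedQuadraticForm k H) (hF : F.IsNondegenerate)
    (h : H) (y : Module.Dual ℤ H) : F.linking hF (F.form h) y = 0 := by
  rw [linking_apply, inverseForm_form, coe_int_eq_zero]

theorem refinement_form (F : ExtendedQuadraticForm k H) (hF : F.IsNondegenerate) (h : H) :
    F.refinement hF (F.form h) = 0 := by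
  obtain ⟨c, he, -, -, hc⟩ := F.exists_characteristic hF
  obtain ⟨m, hm⟩ := he h
  rw [hc, inverseForm_form, inverseForm_form, ← Int.cast_add, hm, ← coe_int_eq_zero m]
  congr 1
  push_cast
  ring

theorem refinement_congr (F : ExtendedQuadraticForm k H) (hF : F.IsNondegenerate)
    (x y : Module.Dual ℤ H) (h : y - x ∈ LinearMap.range F.form) :
    F.refinement hF x = F.refinement hF y := by
  obtain ⟨z, hz⟩ := h
  have := F.refinement_add hF x (F.form z)
  rw [refinement_form, linking_symm, linking_form, hz, sub_zero, sub_eq_zero] at this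
  rw [← this]
  congr 1
  abel

/-- The linking form `b` of the boundary: `b (π x, π y) = λ⁻¹(x, y)` modulo `ℤ`. -/
def boundaryLinking (F : ExtendedQuadraticForm k H) (hF : F.IsNondegenerate) :
    F.Coker →+ F.Coker →+ AddCircle (1 : ℚ) :=
  QuotientAddGroup.lift _
    (AddMonoidHom.mk' (fun x => QuotientAddGroup.lift (LinearMap.range F.form).toAddSubgroup
        (F.linking hF x) (by
          rintro _ ⟨h, rfl⟩
          exact (F.linking_symm hF _ _).trans (F.linking_form hF h x)))
      fun x x' => by
        ext y
        induction y using QuotientAddGroup.induction_on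
        exact DFunLike.congr_fun ((F.linking hF).map_add x x') _)
    (by
      rintro _ ⟨h, rfl⟩
      ext y
      induction y using QuotientAddGroup.induction_on
      exact F.linking_form hF h _)

theorem boundaryLinking_mk (F : ExtendedQuadraticForm k H) (hF : F.IsNondegenerate)
    (x y : Module.Dual ℤ H) :
    F.boundaryLinking hF (Submodule.Quotient.mk x) (Submodule.Quotient.mk y) =
      ((F.inverseForm hF x y : ℚ) : AddCircle (1 : ℚ)) := rfl

/-- The quadratic refinement `q` of the boundary. -/
def boundaryRefinement (F : ExtendedQuadraticForm k H) (hF : F.IsNondegenerate) :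
    F.Coker → AddCircle (1 : ℚ) :=
  Quotient.lift (F.refinement hF) fun x y h =>
    F.refinement_congr hF x y (by
      have h' := QuotientAddGroup.leftRel_apply.mp h
      rwa [neg_add_eq_sub] at h')

theorem boundaryRefinement_mk (F : ExtendedQuadraticForm k H) (hF : F.IsNondegenerate)
    (x : Module.Dual ℤ H) :
    F.boundaryRefinement hF (Submodule.Quotient.mk x) = F.refinement hF x := rfl

/-- The element `β` of the boundary: the image of `α ∈ Hom(H, π_{2k-1}(SO)) = H^* ⊗ π_{2k-1}(SO)`
in `G ⊗ π_{2k-1}(SO)`. -/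
def boundaryStable (F : ExtendedQuadraticForm k H) : F.Coker ⊗[ℤ] StableGroup k :=
  LinearMap.rTensor (StableGroup k) (LinearMap.range F.form).mkQ
    ((dualTensorHomEquiv ℤ H (StableGroup k)).symm F.stable)

theorem boundaryStable_eq (F : ExtendedQuadraticForm k H) (h : IsExceptional k) :
    F.boundaryStable =
      (Submodule.Quotient.mk (F.stableDual h) : F.Coker) ⊗ₜ[ℤ] (1 : StableGroup k) := by
  have e : (dualTensorHomEquiv ℤ H (StableGroup k)).symm F.stable =
      F.stableDual h ⊗ₜ[ℤ] (1 : StableGroup k) := by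
    rw [LinearEquiv.symm_apply_eq]
    ext x
    simp only [dualTensorHomEquiv, LinearEquiv.ofBijective_apply, dualTensorHom_apply,
      stableDual_apply]
    apply (stableGroupInt h).injective
    simp
  rw [boundaryStable, e]
  rfl

/-- A covector with the parity of a symmetric form on the diagonal is twice a covector modulo the
image of the adjoint. -/
theorem exists_half (f : H →ₗ[ℤ] H →ₗ[ℤ] ℤ) (hf : ∀ x y, f x y = f y x) (c : Module.Dual ℤ H)
    (hc : ∀ x, Even (f x x + c x)) : ∃ (g : Module.Dual ℤ H) (w : H), c = f w + 2 • g := by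
  have hsq : ∀ a : ZMod 2, a * a = a := by decide
  have hlift : ∀ z : ZMod 2 ⊗[ℤ] H, ∃ w : H, (1 : ZMod 2) ⊗ₜ[ℤ] w = z := by
    intro z
    induction z using TensorProduct.induction_on with
    | zero => exact ⟨0, by simp⟩
    | add z₁ z₂ h₁ h₂ =>
      obtain ⟨w₁, rfl⟩ := h₁
      obtain ⟨w₂, rfl⟩ := h₂
      exact ⟨w₁ + w₂, TensorProduct.tmul_add _ _ _⟩
    | tmul a x =>
      refine ⟨(a.val : ℤ) • x, ?_⟩
      rw [← TensorProduct.smul_tmul]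
      congr 1
      simp
  let B : LinearMap.BilinForm (ZMod 2) (ZMod 2 ⊗[ℤ] H) :=
    LinearMap.BilinForm.baseChange (ZMod 2) f
  let d : Module.Dual (ZMod 2) (ZMod 2 ⊗[ℤ] H) := Module.Dual.baseChange (ZMod 2) c
  have hB : ∀ a b x y, B (a ⊗ₜ x) (b ⊗ₜ y) = (f x y : ZMod 2) * (a * b) := by
    intro a b x y
    simp [B, LinearMap.BilinForm.baseChange_tmul]
  have hd : ∀ a x, d (a ⊗ₜ x) = (c x : ZMod 2) * a := by
    intro a x
    simp [d]
  have hs : ∀ z w, B z w = B w z := by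
    intro z w
    induction z using TensorProduct.induction_on with
    | zero => simp
    | add z₁ z₂ h₁ h₂ => simp [h₁, h₂]
    | tmul a x =>
      induction w using TensorProduct.induction_on with
      | zero => simp
      | add w₁ w₂ h₁ h₂ => simp [h₁, h₂]
      | tmul b y => rw [hB, hB, hf, mul_comm a b]
  have hdiag : ∀ z, B z z = d z := by
    intro z
    induction z using TensorProduct.induction_on with
    | zero => simp
    | add z w hz hw =>
      have h2 : B z w + B z w = 0 := CharTwo.add_self_eq_zero _
      simp only [map_add, LinearMap.add_apply, hz, hw, hs w z]
      linear_combination h2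
    | tmul a x =>
      rw [hB, hd]
      have h1 : ((f x x : ℤ) : ZMod 2) = (c x : ZMod 2) := by
        have := (ZMod.intCast_zmod_eq_zero_iff_dvd _ 2).2 (by exact_mod_cast (hc x).two_dvd)
        push_cast at this
        exact CharTwo.add_eq_zero.mp this
      rw [h1, hsq]
  have hmem : d ∈ LinearMap.range B := by
    rw [← Subspace.dualCoannihilator_dualAnnihilator_eq (W := LinearMap.range B),
      Submodule.mem_dualAnnihilator]
    intro v hv
    rw [Submodule.mem_dualCoannihilator] at hv
    rw [← hdiag]
    exact hv _ ⟨v, rfl⟩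
  obtain ⟨z, hz⟩ := hmem
  obtain ⟨w, rfl⟩ := hlift z
  have hpar : ∀ x, (2 : ℤ) ∣ (c - f w) x := by
    intro x
    have h1 := LinearMap.congr_fun hz (1 ⊗ₜ x)
    rw [hB, hd] at h1
    have h2 : (((c - f w) x : ℤ) : ZMod 2) = 0 := by
      rw [LinearMap.sub_apply]
      push_cast
      rw [sub_eq_zero]
      simpa using h1.symm
    exact_mod_cast (ZMod.intCast_zmod_eq_zero_iff_dvd _ 2).1 h2
  refine ⟨{ toFun := fun x => (c - f w) x / 2, map_add' := ?_, map_smul' := ?_ }, w, ?_⟩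
  · intro x y
    rw [map_add, Int.add_ediv_of_dvd_left (hpar x)]
  · intro n x
    rw [map_smul, smul_eq_mul, Int.mul_ediv_assoc _ (hpar x)]
    rfl
  · ext x
    have := Int.mul_ediv_cancel' (hpar x)
    simp only [LinearMap.add_apply, LinearMap.smul_apply, LinearMap.coe_mk, AddHom.coe_mk,
      LinearMap.sub_apply] at this ⊢
    rw [nsmul_eq_mul]
    push_cast
    rw [this]
    ring

theorem boundaryLinking_nonsingular (F : ExtendedQuadraticForm k H) (hF : F.IsNondegenerate)
    (x : F.Coker) (hx : ∀ y, F.boundaryLinking hF x y = 0) : x = 0 := by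
  obtain ⟨x, rfl⟩ := Submodule.Quotient.mk_surjective _ x
  have := F.finite_coker hF
  set n : ℕ := Nat.card F.Coker with hn
  have hn0 : (n : ℤ) ≠ 0 := by exact_mod_cast Nat.card_pos.ne'
  have hmem : n • x ∈ LinearMap.range F.form := by
    rw [← Submodule.Quotient.mk_eq_zero, Submodule.Quotient.mk_smul]
    exact card_nsmul_eq_zero'
  obtain ⟨h, hh⟩ := hmem
  have hdvd : ∀ y : Module.Dual ℤ H, (n : ℤ) ∣ y h := by
    intro y
    have h0 := hx (Submodule.Quotient.mk y)
    rw [boundaryLinking_mk, AddCircle.coe_eq_zero_iff] at h0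
    obtain ⟨m, hm⟩ := h0
    have h1 := F.inverseForm_form hF h y
    rw [hh, inverseForm_nsmul_left, ← hm] at h1
    refine ⟨m, ?_⟩
    have h2 : ((n * m : ℤ) : ℚ) = (y h : ℤ) := by
      rw [← h1]
      simp
    exact_mod_cast h2.symm
  let B := Module.Free.chooseBasis ℤ H
  let h' : H := ∑ i, (B.repr h i / (n : ℤ)) • B i
  have hh' : (n : ℤ) • h' = h := by
    conv_rhs => rw [← B.sum_repr h]
    rw [Finset.smul_sum]
    refine Finset.sum_congr rfl fun i _ => ?_
    rw [smul_smul, Int.mul_ediv_cancel' (show (n : ℤ) ∣ B.repr h i from hdvd (B.coord i))]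
  rw [Submodule.Quotient.mk_eq_zero]
  refine ⟨h', ?_⟩
  ext v
  apply mul_left_cancel₀ hn0
  have h3 := LinearMap.congr_fun hh v
  rw [← hh'] at h3
  simpa using h3

/-- The algebraic boundary of a nondegenerate extended quadratic form. -/
def boundary (F : ExtendedQuadraticForm k H) (hF : F.IsNondegenerate) :
    ExtendedQuadraticLinkingForm k F.Coker where
  finite := F.finite_coker hF
  b := F.boundaryLinking hF
  b_symm := by
    rintro ⟨x⟩ ⟨y⟩
    exact F.linking_symm hF x y
  b_nonsingular := F.boundaryLinking_nonsingular hF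
  q := F.boundaryRefinement hF
  q_refines := by
    rintro ⟨x⟩ ⟨y⟩
    exact F.refinement_add hF x y
  β := F.boundaryStable
  defect := by
    intro h
    obtain ⟨c, he, hc, -, hq⟩ := F.exists_characteristic hF
    obtain ⟨g, w, hg⟩ := exists_half F.form F.form_symm c he
    have hcg : (Submodule.Quotient.mk c : F.Coker) = 2 • Submodule.Quotient.mk g := by
      rw [← Submodule.Quotient.mk_smul, Submodule.Quotient.eq, hg]
      exact ⟨w, by abel⟩
    refine ⟨Submodule.Quotient.mk g, ?_, ?_⟩
    · rw [boundaryStable_eq F h, ← hcg, hc h]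
    · rw [← hcg]
      rintro ⟨x⟩
      change F.refinement hF x - F.refinement hF (-x) =
        ((F.inverseForm hF x c : ℚ) : AddCircle (1 : ℚ))
      rw [hq, hq, ← AddCircle.coe_sub]
      congr 1
      rw [inverseForm_neg_left, inverseForm_neg_left, F.inverseForm_symm hF x (-x),
        inverseForm_neg_left]
      ring
  homogeneous := by
    rintro h ⟨x⟩
    change F.refinement hF x = F.refinement hF (-x)
    simp only [refinement, h, dite_false]
    rw [inverseForm_neg_left, F.inverseForm_symm hF x (-x), inverseForm_neg_left, neg_neg]

end ExtendedQuadraticForm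

end

/-! All tree labels can be taken even, which separates the quadratic form from the stable class. For
`k = 2, 4`, choose `g₀` with `β = 2 g₀` and replace `q` by `q - b(·, g₀)`, which is homogeneous
(`exists_homogeneous`). If an even form has boundary `(G, b, q - b(·, g₀))` and `a ∈ H^*` lifts
`g₀`, then `α = 2a` is characteristic, maps to `β`, and the term `λ⁻¹(x, α) / 2 = λ⁻¹(x, a)` puts
`b(·, g₀)` back. In the other dimensions `α` is any lift of `β`.

It remains to realize every nonsingular homogeneous `(G, b, q)` by an even tree. The group splits
orthogonally into cyclic `p`-groups and pairs of generators of 2-power order with `b` even on the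
diagonal (`exists_isRealizableSummand`). A cyclic block is a fraction `s / p` with `p * s` even; its
continued fraction with even coefficients is a path (`exists_isRooted`). A pair is realized by three
pieces meeting at a vertex (`IsRooted.isGeneratedTree_pair`).

Orthogonal sums must be trees as well, not forests. An edge ending at a neutral vertex, where the
column of the inverse matrix is integral with zero diagonal entry, does not change the isomorphism
class of the sum (`IsRealization.link`), and the vertex stays neutral. A hyperbolic plane supplies
the first neutral vertex. -/

open Matrix

/-! ### Even trees and joining two trees by an edge. -/

/-- A symmetric integral matrix which is the matrix of a labelled tree with even labels. -/
def IsEvenTreeMatrix {V : Type} (M : Matrix V V ℤ) : Prop :=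
  ∃ Γ : SimpleGraph V, Γ.IsTree ∧ (∀ v, Even (M v v)) ∧
    ∀ i j, i ≠ j → (Γ.Adj i j → M i j = 1) ∧ (¬ Γ.Adj i j → M i j = 0)

/-- Trees are the connected graphs with one edge fewer than vertices, and the bridge contributes
exactly the missing edge. -/
theorem SimpleGraph.IsTree.sum_sup_edge {V W : Type*} [Finite V] [Finite W] {G : SimpleGraph V}
    {H : SimpleGraph W} (hG : G.IsTree) (hH : H.IsTree) (v : V) (w : W) :
    ((G ⊕g H) ⊔ SimpleGraph.edge (Sum.inl v) (Sum.inr w)).IsTree := by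
  rw [SimpleGraph.isTree_iff_connected_and_card] at hG hH ⊢
  refine ⟨SimpleGraph.Connected.sum_sup_edge hG.1 hH.1, ?_⟩
  have h1 : ((G ⊕g H) ⊔ SimpleGraph.edge (Sum.inl v) (Sum.inr w)).edgeSet =
      insert s(Sum.inl v, Sum.inr w) (G ⊕g H).edgeSet := by
    rw [SimpleGraph.edgeSet_sup, SimpleGraph.edgeSet_edge_of_ne (by simp), Set.union_comm]
    rfl
  rw [h1, Nat.card_coe_set_eq, Set.ncard_insert_of_notMem (by simp), ← Nat.card_coe_set_eq,
    Nat.card_congr SimpleGraph.edgeSetSumEquiv, Nat.card_sum, Nat.card_sum, ← hG.2, ← hH.2]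
  ring

section
variable {V W : Type} [Fintype V] [Fintype W] [DecidableEq V] [DecidableEq W]

theorem IsEvenTreeMatrix.symm {M : Matrix V V ℤ} (h : IsEvenTreeMatrix M) (i j : V) :
    M i j = M j i := by
  obtain ⟨Γ, -, -, h⟩ := h
  by_cases e : i = j
  · rw [e]
  · by_cases a : Γ.Adj i j
    · rw [(h i j e).1 a, (h j i (Ne.symm e)).1 a.symm]
    · rw [(h i j e).2 a, (h j i (Ne.symm e)).2 fun b => a b.symm]

theorem isEvenTreeMatrix_unit {a : ℤ} (ha : Even a) :
    IsEvenTreeMatrix (Matrix.of fun _ _ : Unit => a) :=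
  ⟨⊥, SimpleGraph.IsTree.of_subsingleton, fun _ => ha, fun _ _ h => absurd rfl h⟩

/-- The matrix of the tree obtained by joining two trees by an edge. -/
def linkMatrix (M : Matrix V V ℤ) (N : Matrix W W ℤ) (v : V) (w : W) : Matrix (V ⊕ W) (V ⊕ W) ℤ :=
  Matrix.fromBlocks M (Matrix.single v w 1) (Matrix.single w v 1) N

theorem IsEvenTreeMatrix.link {M : Matrix V V ℤ} {N : Matrix W W ℤ} (hM : IsEvenTreeMatrix M)
    (hN : IsEvenTreeMatrix N) (v : V) (w : W) : IsEvenTreeMatrix (linkMatrix M N v w) := by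
  obtain ⟨Γ, hΓ, h1, h2⟩ := hM
  obtain ⟨Γ', hΓ', h1', h2'⟩ := hN
  refine ⟨_, hΓ.sum_sup_edge hΓ' v w, ?_, ?_⟩
  · rintro (i | i)
    · exact h1 i
    · exact h1' i
  · rintro (i | i) (j | j) hij
    · simpa [linkMatrix, SimpleGraph.edge_adj] using h2 i j (by simpa using hij)
    · simp [linkMatrix, SimpleGraph.edge_adj, Matrix.single_apply]
      grind
    · simp [linkMatrix, SimpleGraph.edge_adj, Matrix.single_apply]
      grind
    · simpa [linkMatrix, SimpleGraph.edge_adj] using h2' i j (by simpa using hij)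

theorem linkMatrix_mulVec (M : Matrix V V ℤ) (N : Matrix W W ℤ) (v : V) (w : W) (x : V → ℤ)
    (y : W → ℤ) : linkMatrix M N v w *ᵥ Sum.elim x y =
      Sum.elim (M *ᵥ x + Pi.single v (y w)) (N *ᵥ y + Pi.single w (x v)) := by
  rw [linkMatrix, Matrix.fromBlocks_mulVec]
  congr 1
  · ext i
    simp [Matrix.single_mulVec, Function.update_apply, Pi.single_apply]
  · ext i
    simp [Matrix.single_mulVec, Function.update_apply, Pi.single_apply]
    ring

/-! ### Rooted trees and even continued fractions. -/

/-- A matrix `M` with vertex `r` for which the vertex entry of the inverse is `s / p`, which is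
nondegenerate on the complement of `r`, and whose cokernel is generated by the dual of `r`. -/
structure IsRooted (M : Matrix V V ℤ) (r : V) (p s : ℤ) : Prop where
  tree : IsEvenTreeMatrix M
  green : ∃ u : V → ℤ, M *ᵥ u = Pi.single r p ∧ u r = s
  inj : ∀ x, M *ᵥ x = 0 → x r = 0 → x = 0
  gen : ∀ y, ∃ (c : ℤ) (x : V → ℤ), y = M *ᵥ x + Pi.single r c

theorem isRooted_unit {a : ℤ} (ha : Even a) :
    IsRooted (Matrix.of fun _ _ : Unit => a) () a 1 where
  tree := isEvenTreeMatrix_unit ha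
  green := ⟨fun _ => 1, by ext; simp [Matrix.mulVec, dotProduct], rfl⟩
  inj x _ h := funext fun _ => h
  gen y := ⟨y (), 0, by ext; simp⟩

theorem IsRooted.neg {M : Matrix V V ℤ} {r : V} {p s : ℤ} (h : IsRooted M r p s) :
    IsRooted M r (-p) (-s) where
  tree := h.tree
  green := by
    obtain ⟨u, h1, h2⟩ := h.green
    exact ⟨-u, by rw [Matrix.mulVec_neg, h1, Pi.single_neg], by simp [h2]⟩
  inj := h.inj
  gen := h.gen

/-- One step of a continued fraction: the inverse entry at the new root is `1 / (a - s / p)`. Since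
only the pair of integers is recorded, `p = 0` is allowed along the way. -/
theorem IsRooted.link_unit {M : Matrix V V ℤ} {r : V} {p s : ℤ} (h : IsRooted M r p s) {a : ℤ}
    (ha : Even a) : IsRooted (linkMatrix (Matrix.of fun _ _ : Unit => a) M () r) (Sum.inl ())
      (a * p - s) p where
  tree := (isEvenTreeMatrix_unit ha).link h.tree () r
  green := by
    obtain ⟨u, h1, h2⟩ := h.green
    refine ⟨Sum.elim (fun _ => p) (-u), ?_, rfl⟩
    rw [linkMatrix_mulVec, Matrix.mulVec_neg, h1]
    ext (i | i)
    · simp [Matrix.mulVec, dotProduct, h2, sub_eq_add_neg]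
    · simp
  inj x hx h0 := by
    obtain ⟨x, y, rfl⟩ : ∃ y z, x = Sum.elim y z := ⟨_, _, (Sum.elim_comp_inl_inr x).symm⟩
    have hx0 : x = 0 := funext fun _ => h0
    rw [linkMatrix_mulVec, hx0] at hx
    have h1 : y r = 0 := by simpa using congrFun hx (Sum.inl ())
    have h2 : M *ᵥ y = 0 := by
      ext i
      simpa using congrFun hx (Sum.inr i)
    rw [hx0, h.inj y h2 h1, Sum.elim_zero_zero]
  gen y := by
    obtain ⟨x, y, rfl⟩ : ∃ z w, y = Sum.elim z w := ⟨_, _, (Sum.elim_comp_inl_inr y).symm⟩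
    obtain ⟨c, z, hz⟩ := h.gen y
    -- The value `c` at the new vertex supplies `c` times the dual of the old root; only an error at
    -- the new root remains.
    refine ⟨x () - a * c - z r, Sum.elim (fun _ => c) z, ?_⟩
    rw [linkMatrix_mulVec, hz]
    ext (i | i)
    · simp [Matrix.mulVec, dotProduct]
    · simp

end

/-- Division with remainder by `2 * s`, centred by the shift `|s|`: the even multiples of `s` are `2
* |s|` apart, so one lies within `|s|` of `p`. -/
theorem exists_even_mul_sub_natAbs_le (s p : ℤ) (hs : s ≠ 0) :
    ∃ a : ℤ, Even a ∧ (a * s - p).natAbs ≤ s.natAbs := by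
  refine ⟨2 * ((p + |s|) / (2 * s)), even_two_mul _, ?_⟩
  have h1 := Int.emod_add_mul_ediv (p + |s|) (2 * s)
  have h2 := Int.emod_nonneg (p + |s|) (b := 2 * s) (by omega)
  have h3 := Int.emod_lt_abs (p + |s|) (b := 2 * s) (by omega)
  have h4 : 2 * ((p + |s|) / (2 * s)) * s = 2 * s * ((p + |s|) / (2 * s)) := by ring
  rw [h4]
  rw [abs_mul] at h3
  generalize (p + |s|) % (2 * s) = y at *
  generalize 2 * s * ((p + |s|) / (2 * s)) = z at *
  simp only [Nat.abs_ofNat] at h3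
  rcases abs_cases s with h | h <;> omega

/-- Every fraction `s / p` in lowest terms with `p * s` even has an even continued fraction. -/
theorem exists_isRooted (p s : ℤ) (hc : IsCoprime p s) (he : Even (p * s)) :
    ∃ (V : Type) (_ : Fintype V) (_ : DecidableEq V) (M : Matrix V V ℤ) (r : V),
      IsRooted M r p s := by
  induction hn : s.natAbs using Nat.strong_induction_on generalizing p s with
  | _ n ih =>
  have hunit : ∀ p : ℤ, Even p → ∀ s : ℤ, IsUnit s → ∃ (V : Type) (_ : Fintype V)
      (_ : DecidableEq V) (M : Matrix V V ℤ) (r : V), IsRooted M r p s := by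
    intro p hp s hs
    rcases Int.isUnit_iff.mp hs with rfl | rfl
    · exact ⟨_, _, _, _, _, isRooted_unit hp⟩
    · refine ⟨_, _, _, _, _, by simpa using (isRooted_unit hp.neg).neg⟩
  by_cases hs : IsUnit s
  · refine hunit p ?_ s hs
    rcases Int.isUnit_iff.mp hs with rfl | rfl <;> simpa using he
  · by_cases hs0 : s = 0
    · subst hs0
      have hp : IsUnit p := isCoprime_zero_right.mp hc
      obtain ⟨V, _, _, M, r, h⟩ := hunit 0 (by simp) (-p) (by simpa using hp)
      exact ⟨_, _, _, _, _, by simpa using h.link_unit (a := 0) (by simp)⟩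
    · obtain ⟨a, ha, hle⟩ := exists_even_mul_sub_natAbs_le s p hs0
      have hc' : IsCoprime s (a * s - p) := by
        have := (hc.symm.neg_right).add_mul_left_right a
        rwa [show -p + s * a = a * s - p by ring] at this
      have hlt : (a * s - p).natAbs < n := by
        -- If rounding does not decrease the absolute value, then `a * s - p = ± s`, so coprimality
        -- makes `s` a unit.
        refine lt_of_le_of_ne (hn ▸ hle) fun e => hs ?_
        rw [← hn, Int.natAbs_eq_natAbs_iff] at e
        rcases e with e | e
        · rw [e] at hc'
          exact isCoprime_self.mp hc'
        · rw [e] at hc'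
          exact isCoprime_self.mp (by simpa using hc'.neg_right)
      obtain ⟨V, _, _, M, r, h⟩ := ih _ hlt s (a * s - p) hc' (by
        rw [mul_sub, show s * (a * s) = a * (s * s) by ring, mul_comm s p]
        exact (ha.mul_right _).sub he) rfl
      have := h.link_unit ha
      rw [sub_sub_cancel] at this
      exact ⟨_, _, _, _, _, this⟩

/-! ### Trees whose cokernel is generated by several vertices. -/

section
variable {V W : Type} [Fintype V] [Fintype W] [DecidableEq V] [DecidableEq W]

theorem IsEvenTreeMatrix.mulVec_dotProduct {M : Matrix V V ℤ} (h : IsEvenTreeMatrix M)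
    (x y : V → ℤ) : (M *ᵥ x) ⬝ᵥ y = x ⬝ᵥ (M *ᵥ y) := by
  have hM : Mᵀ = M := by
    ext i j
    exact h.symm j i
  rw [Matrix.dotProduct_mulVec, ← Matrix.mulVec_transpose, hM]

/-- A nondegenerate even tree matrix whose cokernel is generated by the duals of the vertices
`σ i`, on which the inverse matrix has the entries `A i j / n`. -/
structure IsGeneratedTree {ι : Type} [Fintype ι] (M : Matrix V V ℤ) (σ : ι → V) (n : ℤ)
    (A : ι → ι → ℤ) : Prop where
  tree : IsEvenTreeMatrix M
  ne_zero : n ≠ 0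
  injective : Function.Injective σ
  green : ∀ i, ∃ u : V → ℤ, M *ᵥ u = Pi.single (σ i) n ∧ ∀ j, u (σ j) = A i j
  inj : ∀ x, M *ᵥ x = 0 → (∀ i, x (σ i) = 0) → x = 0
  gen : ∀ y, ∃ (c : ι → ℤ) (x : V → ℤ), y = M *ᵥ x + ∑ i, Pi.single (σ i) (c i)

/-- Pairing a kernel vector `x` with the solution of `M u = n e_{σ i}` gives `n * x (σ i) = 0`. -/
theorem IsGeneratedTree.det_ne_zero {ι : Type} [Fintype ι] {M : Matrix V V ℤ} {σ : ι → V} {n : ℤ}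
    {A : ι → ι → ℤ} (h : IsGeneratedTree M σ n A) : M.det ≠ 0 := by
  rw [Ne, ← Matrix.exists_mulVec_eq_zero_iff]
  rintro ⟨x, hx, hx0⟩
  refine hx (h.inj x hx0 fun i => ?_)
  obtain ⟨u, hu, -⟩ := h.green i
  have := h.tree.mulVec_dotProduct u x
  rw [hu, hx0] at this
  simpa [h.ne_zero] using this

theorem IsRooted.isGeneratedTree {M : Matrix V V ℤ} {r : V} {p s : ℤ} (h : IsRooted M r p s)
    (hp : p ≠ 0) : IsGeneratedTree M (fun _ : Unit => r) p (fun _ _ => s) where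
  tree := h.tree
  ne_zero := hp
  injective _ _ _ := rfl
  green _ := by
    obtain ⟨u, h1, h2⟩ := h.green
    exact ⟨u, h1, fun _ => h2⟩
  inj x hx h0 := h.inj x hx (h0 ())
  gen y := by
    obtain ⟨c, x, hx⟩ := h.gen y
    exact ⟨fun _ => c, x, by simpa using hx⟩

/-- The tree of a linking form on a free `ℤ/n`-module of rank two. -/
theorem IsRooted.isGeneratedTree_pair {M : Matrix V V ℤ} {N : Matrix W W ℤ} {v : V} {w : W}
    {n g d t : ℤ} (hn : n ≠ 0) (he : Even n) (ht : t = g * d - 1) (hM : IsRooted M v (d + 1) n)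
    (hN : IsRooted N w (n * g) t) :
    IsGeneratedTree
      (linkMatrix (linkMatrix (Matrix.of fun _ _ : Unit => n) M () v) N (Sum.inr v) w)
      ![Sum.inl (Sum.inl ()), Sum.inr w] n ![![g + 1, t], ![t, d * t]] := by
  have key : ∀ (x : Unit → ℤ) (y : V → ℤ) (z : W → ℤ),
      linkMatrix (linkMatrix (Matrix.of fun _ _ : Unit => n) M () v) N (Sum.inr v) w *ᵥ
        Sum.elim (Sum.elim x y) z = Sum.elim (Sum.elim (fun _ => n * x () + y v)
          (M *ᵥ y + Pi.single v (x () + z w))) (N *ᵥ z + Pi.single w (y v)) := by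
    intro x y z
    rw [linkMatrix_mulVec, linkMatrix_mulVec]
    ext ((i | i) | i)
    · simp [Matrix.mulVec, dotProduct]
    · simp [Pi.single_add, add_assoc, Pi.single_apply]
    · simp
  -- Heuristically, eliminating all vertices but the single one, `v` and `w` leaves a path with
  -- labels `n`, `(d + 1) / n` and `n * g / t`. Its determinant is `n * (g * d - t) / t`, so `t = g
  -- * d - 1` makes it `n / t` and gives the inverse entries denominator `n`. The vectors below are
  -- `n` times the two relevant columns.
  obtain ⟨u, hu, huv⟩ := hM.green
  obtain ⟨u', hu', huw⟩ := hN.green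
  refine ⟨((isEvenTreeMatrix_unit he).link hM.tree _ _).link hN.tree _ _, hn, ?_, ?_, ?_, ?_⟩
  · intro i j
    fin_cases i <;> fin_cases j <;> simp
  · rw [Fin.forall_fin_two]
    constructor
    · refine ⟨Sum.elim (Sum.elim (fun _ => g + 1) (-g • u)) u', ?_, ?_⟩
      · rw [key, Matrix.mulVec_smul, hu, hu']
        ext ((i | i) | i)
        · simp [huv]
          ring
        · simp [Pi.single_apply, huw]
          rw [ht]
          split_ifs <;> ring
        · simp [Pi.single_apply, huv]
          split_ifs <;> ring
      · simp [Fin.forall_fin_two, huw]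
    · refine ⟨Sum.elim (Sum.elim (fun _ => t) (-t • u)) (d • u'), ?_, ?_⟩
      · rw [key, Matrix.mulVec_smul, Matrix.mulVec_smul, hu, hu']
        ext ((i | i) | i)
        · simp [huv]
          ring
        · simp [Pi.single_apply, huw]
          split_ifs <;> ring
        · simp [Pi.single_apply, huv]
          rw [ht]
          split_ifs <;> ring
      · simp [Fin.forall_fin_two, huw]
  · intro x hx h0
    obtain ⟨x, z, rfl⟩ : ∃ y z, x = Sum.elim y z := ⟨_, _, (Sum.elim_comp_inl_inr x).symm⟩
    obtain ⟨x, y, rfl⟩ : ∃ y z, x = Sum.elim y z := ⟨_, _, (Sum.elim_comp_inl_inr x).symm⟩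
    have hx0 : x () = 0 := h0 0
    have hz0 : z w = 0 := h0 1
    rw [key] at hx
    have hy0 : y v = 0 := by simpa [hx0] using congrFun hx (Sum.inl (Sum.inl ()))
    have hy : y = 0 := hM.inj y (by
      ext i
      simpa [hx0, hz0] using congrFun hx (Sum.inl (Sum.inr i))) hy0
    have hz : z = 0 := hN.inj z (by
      ext i
      simpa [hy0] using congrFun hx (Sum.inr i)) hz0
    rw [hy, hz, show x = 0 from funext fun _ => hx0, Sum.elim_zero_zero, Sum.elim_zero_zero]
  · intro x
    obtain ⟨x, z, rfl⟩ : ∃ y z, x = Sum.elim y z := ⟨_, _, (Sum.elim_comp_inl_inr x).symm⟩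
    obtain ⟨x, y, rfl⟩ : ∃ y z, x = Sum.elim y z := ⟨_, _, (Sum.elim_comp_inl_inr x).symm⟩
    obtain ⟨c, y', hy⟩ := hM.gen y
    obtain ⟨c', z', hz⟩ := hN.gen z
    refine ⟨![x () - n * (c - z' w) - y' v, c' - y' v],
      Sum.elim (Sum.elim (fun _ => c - z' w) y') z', ?_⟩
    rw [key, hy, hz, Fin.sum_univ_two]
    ext ((i | i) | i)
    · simp
    · simp
    · simp [Pi.single_apply]
      split_ifs <;> ring
end

/-! ### Quadratic functions in coordinates. -/

theorem eq_zero_of_additive_of_single {ι A : Type*} [Fintype ι] [DecidableEq ι] [AddCommGroup A]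
    (f : (ι → ℤ) → A) (hf : ∀ x y, f (x + y) = f x + f y) (h : ∀ i, f (Pi.single i 1) = 0)
    (x : ι → ℤ) : f x = 0 := by
  have : (AddMonoidHom.mk' f hf).toIntLinearMap = 0 := by
    refine LinearMap.pi_ext' fun i => LinearMap.ext_ring ?_
    simpa using h i
  exact LinearMap.congr_fun this x

/-- The rational vector of an integral vector. -/
def ratVec {ι : Type*} (x : ι → ℤ) : ι → ℚ := fun i => x i

section ratVec
variable {ι : Type*}

@[simp] theorem ratVec_apply (x : ι → ℤ) (i : ι) : ratVec x i = x i := rfl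

theorem ratVec_add (x y : ι → ℤ) : ratVec (x + y) = ratVec x + ratVec y := by
  ext
  simp

theorem ratVec_single [DecidableEq ι] (i : ι) (n : ℤ) :
    ratVec (Pi.single i n) = Pi.single i (n : ℚ) := by
  ext j
  by_cases h : j = i
  · subst h; simp
  · simp [h]

theorem ratVec_dotProduct [Fintype ι] (x y : ι → ℤ) :
    ratVec x ⬝ᵥ ratVec y = ((x ⬝ᵥ y : ℤ) : ℚ) := by
  simp [dotProduct]

theorem ratVec_mulVec [Fintype ι] (M : Matrix ι ι ℤ) (x : ι → ℤ) :
    ratVec (M *ᵥ x) = (M.map (Int.cast : ℤ → ℚ)) *ᵥ ratVec x := by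
  ext i
  simp [Matrix.mulVec, dotProduct]

end ratVec

section refinement
variable {G ι : Type*} [AddCommGroup G] [Fintype ι] [DecidableEq ι]
  {b : G →+ G →+ AddCircle (1 : ℚ)} {q : G → AddCircle (1 : ℚ)}

theorem pairing_sum_zsmul {h : ι → G} {w : Matrix ι ι ℚ}
    (hb : ∀ i j, b (h i) (h j) = ((w i j : ℚ) : AddCircle (1 : ℚ))) (c d : ι → ℤ) :
    b (∑ i, c i • h i) (∑ i, d i • h i) =
      ((ratVec c ⬝ᵥ (w *ᵥ ratVec d) : ℚ) : AddCircle (1 : ℚ)) := by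
  have hπ : ∀ x : ℚ, (x : AddCircle (1 : ℚ)) = QuotientAddGroup.mk' _ x := fun _ => rfl
  rw [hπ]
  simp only [map_sum, map_zsmul, AddMonoidHom.finsetSum_apply, AddMonoidHom.zsmul_apply, hb,
    dotProduct, Matrix.mulVec, Finset.mul_sum, ratVec_apply, hπ, Finset.smul_sum]
  rw [Finset.sum_comm]
  refine Finset.sum_congr rfl fun i _ => Finset.sum_congr rfl fun j _ => ?_
  rw [← map_zsmul, ← map_zsmul]
  congr 1
  simp only [zsmul_eq_mul]
  ring

/-- Both sides have the same polarization in `c`, so their difference is additive; it vanishes on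
the standard basis. -/
theorem refinement_sum_zsmul (hq : ∀ x y, q (x + y) - q x - q y = b x y) {h : ι → G}
    {w : Matrix ι ι ℚ} (hw : w.IsSymm)
    (hb : ∀ i j, b (h i) (h j) = ((w i j : ℚ) : AddCircle (1 : ℚ)))
    (hqh : ∀ i, q (h i) = ((w i i / 2 : ℚ) : AddCircle (1 : ℚ))) (c : ι → ℤ) :
    q (∑ i, c i • h i) = ((ratVec c ⬝ᵥ (w *ᵥ ratVec c) / 2 : ℚ) : AddCircle (1 : ℚ)) := by
  rw [← sub_eq_zero]
  refine eq_zero_of_additive_of_single (fun c => q (∑ i, c i • h i) -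
    ((ratVec c ⬝ᵥ (w *ᵥ ratVec c) / 2 : ℚ) : AddCircle (1 : ℚ))) ?_ ?_ c
  · intro c d
    have h1 := hq (∑ i, c i • h i) (∑ i, d i • h i)
    rw [pairing_sum_zsmul hb] at h1
    have h2 : ratVec d ⬝ᵥ (w *ᵥ ratVec c) = ratVec c ⬝ᵥ (w *ᵥ ratVec d) := by
      rw [dotProduct_comm, ← Matrix.vecMul_transpose, hw.eq, ← Matrix.dotProduct_mulVec]
    have h3 : ratVec (c + d) ⬝ᵥ (w *ᵥ ratVec (c + d)) / 2 = ratVec c ⬝ᵥ (w *ᵥ ratVec c) / 2 +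
        ratVec d ⬝ᵥ (w *ᵥ ratVec d) / 2 + ratVec c ⬝ᵥ (w *ᵥ ratVec d) := by
      rw [ratVec_add, Matrix.mulVec_add, add_dotProduct, dotProduct_add, dotProduct_add, h2]
      ring
    have h4 : ∑ i, (c + d) i • h i = ∑ i, c i • h i + ∑ i, d i • h i := by
      simp [add_smul, Finset.sum_add_distrib]
    simp only [h3, h4, AddCircle.coe_add, ← h1]
    abel
  · intro i
    have h1 : ∑ j, (Pi.single i 1 : ι → ℤ) j • h j = h i := by
      simp [Pi.single_apply, ite_smul]
    simp only [h1, hqh, ratVec_single]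
    simp

end refinement

/-! ### Realizing a linking form by an even tree. -/

section
variable {V W : Type} [Fintype V] [Fintype W] [DecidableEq V] [DecidableEq W]

theorem IsEvenTreeMatrix.isSymm {M : Matrix V V ℤ} (h : IsEvenTreeMatrix M) : M.IsSymm := by
  ext i j
  exact h.symm j i

/-- Modulo 2 the cross terms cancel in pairs, so the function is additive, and the even labels kill
it on the basis. -/
theorem IsEvenTreeMatrix.even_dotProduct {M : Matrix V V ℤ} (h : IsEvenTreeMatrix M) (x : V → ℤ) :
    Even (x ⬝ᵥ (M *ᵥ x)) := by
  have key := eq_zero_of_additive_of_single (fun x => ((x ⬝ᵥ (M *ᵥ x) : ℤ) : ZMod 2)) ?_ ?_ x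
  · rw [even_iff_two_dvd]
    exact_mod_cast (ZMod.intCast_zmod_eq_zero_iff_dvd _ 2).1 key
  · intro x y
    have h2 : y ⬝ᵥ (M *ᵥ x) = x ⬝ᵥ (M *ᵥ y) := by
      rw [dotProduct_comm, h.mulVec_dotProduct]
    simp only [Matrix.mulVec_add, add_dotProduct, dotProduct_add, h2]
    push_cast
    have h3 := CharTwo.add_self_eq_zero ((x ⬝ᵥ (M *ᵥ y) : ℤ) : ZMod 2)
    linear_combination h3
  · intro i
    obtain ⟨Γ, -, h1, -⟩ := h
    obtain ⟨m, hm⟩ := h1 i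
    simp [hm, CharTwo.add_self_eq_zero]

variable {G : Type*} [AddCommGroup G]

/-- The elements `g v` exhibit the restriction of `(b, q)` to `K` as the boundary of the form of
the even tree matrix `M`, whose inverse is `w`. -/
structure IsRealization (b : G →+ G →+ AddCircle (1 : ℚ)) (q : G → AddCircle (1 : ℚ))
    (K : Submodule ℤ G) (M : Matrix V V ℤ) (w : Matrix V V ℚ) (g : V → G) : Prop where
  tree : IsEvenTreeMatrix M
  mul_eq_one : M.map (Int.cast : ℤ → ℚ) * w = 1
  isSymm : w.IsSymm
  b_eq : ∀ i j, b (g i) (g j) = ((w i j : ℚ) : AddCircle (1 : ℚ))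
  q_eq : ∀ i, q (g i) = ((w i i / 2 : ℚ) : AddCircle (1 : ℚ))
  span_eq : Submodule.span ℤ (Set.range g) = K

/-- Values at the generators suffice: modulo the image of `M`, each dual basis vector is a
combination of the selected ones, and `g` uses the same coefficients. -/
theorem IsGeneratedTree.exists_isRealization {ι : Type} [Fintype ι] [DecidableEq ι]
    {M : Matrix V V ℤ} {σ : ι → V} {n : ℤ} {A : ι → ι → ℤ} (h : IsGeneratedTree M σ n A)
    {b : G →+ G →+ AddCircle (1 : ℚ)} {q : G → AddCircle (1 : ℚ)}
    (hq : ∀ x y, q (x + y) - q x - q y = b x y) (e : ι → G)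
    (hb : ∀ i j, b (e i) (e j) = ((A i j / n : ℚ) : AddCircle (1 : ℚ)))
    (hqe : ∀ i, q (e i) = ((A i i / n / 2 : ℚ) : AddCircle (1 : ℚ))) :
    ∃ w g, IsRealization b q (Submodule.span ℤ (Set.range e)) M w g := by
  set m : Matrix V V ℚ := M.map (Int.cast : ℤ → ℚ) with hm
  have hdet : IsUnit m.det := by
    have : m.det = ((M.det : ℤ) : ℚ) := (Int.cast_det M).symm
    rw [this, isUnit_iff_ne_zero]
    exact_mod_cast h.det_ne_zero
  set w := m⁻¹ with hw
  have hmw : m * w = 1 := Matrix.mul_nonsing_inv m hdet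
  have hwm : w * m = 1 := Matrix.nonsing_inv_mul m hdet
  have hms : m.IsSymm := h.tree.isSymm.map _
  have hws : w.IsSymm := by
    rw [Matrix.IsSymm, hw, Matrix.transpose_nonsing_inv, hms.eq]
  have hn : (n : ℚ) ≠ 0 := by exact_mod_cast h.ne_zero
  have hwσ : ∀ i j, w (σ i) (σ j) = A i j / n := by
    intro i j
    obtain ⟨u, hu, hA⟩ := h.green i
    have h1 : w *ᵥ (m *ᵥ ratVec u) = ratVec u := by
      rw [Matrix.mulVec_mulVec, hwm, Matrix.one_mulVec]
    rw [← ratVec_mulVec, hu, ratVec_single] at h1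
    have h2 := congrFun h1 (σ j)
    simp only [Matrix.mulVec_single, ratVec_apply, hA, Pi.smul_apply, Matrix.col_apply,
      MulOpposite.smul_eq_mul_unop, MulOpposite.unop_op] at h2
    rw [← hws.apply, eq_div_iff hn, h2]
  -- At a selected vertex the coefficients are fixed to be the obvious ones, so that `g (σ i) = e i`
  -- and the span is right.
  have hgen : ∀ v, ∃ (c : ι → ℤ) (x : V → ℤ), Pi.single v 1 =
      M *ᵥ x + ∑ i, Pi.single (σ i) (c i) ∧ ∀ i, σ i = v → c = Pi.single i 1 := by
    intro v
    by_cases hv : ∃ i, σ i = v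
    · obtain ⟨i, rfl⟩ := hv
      refine ⟨Pi.single i 1, 0, ?_, fun j hj => by rw [h.injective hj]⟩
      rw [Finset.sum_eq_single i (by intro j _ hj; simp [hj]) (by simp)]
      simp
    · obtain ⟨c, x, hx⟩ := h.gen (Pi.single v 1)
      exact ⟨c, x, hx, fun i hi => absurd ⟨i, hi⟩ hv⟩
  choose c x hx hc using hgen
  let S : (ι → ℤ) → (V → ℤ) := fun c => ∑ i, Pi.single (σ i) (c i)
  let a : Matrix ι ι ℚ := Matrix.of fun i j => (A i j : ℚ) / n
  have hS : ∀ c d, ratVec (S c) ⬝ᵥ (w *ᵥ ratVec (S d)) = ratVec c ⬝ᵥ (a *ᵥ ratVec d) := by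
    intro c d
    have : ∀ c, ratVec (S c) = ∑ i, Pi.single (σ i) (c i : ℚ) := by
      intro c
      ext v
      simp [S, Finset.sum_apply, Pi.single_apply]
    rw [this, this]
    simp only [sum_dotProduct, Matrix.mulVec_sum, dotProduct_sum, single_dotProduct]
    simp [dotProduct, Matrix.mulVec, Finset.mul_sum, a]
    rw [Finset.sum_comm]
    refine Finset.sum_congr rfl fun i _ => Finset.sum_congr rfl fun j _ => ?_
    simp [Pi.single_apply, hwσ]
  have hwv : ∀ v v', w v v' = ((x v ⬝ᵥ Pi.single v' 1 + S (c v) ⬝ᵥ x v' : ℤ) : ℚ) +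
      ratVec (c v) ⬝ᵥ (a *ᵥ ratVec (c v')) := by
    intro v v'
    have h1 : w v v' = ratVec (Pi.single v 1) ⬝ᵥ (w *ᵥ ratVec (Pi.single v' 1)) := by
      simp [ratVec_single]
    have h2 : ∀ y z, ratVec (M *ᵥ y) ⬝ᵥ (w *ᵥ z) = ratVec y ⬝ᵥ z := by
      intro y z
      rw [ratVec_mulVec, dotProduct_comm, Matrix.dotProduct_mulVec, ← Matrix.mulVec_transpose,
        ← hm, hms.eq, Matrix.mulVec_mulVec, hmw, Matrix.one_mulVec, dotProduct_comm]
    have h3 : w *ᵥ ratVec (Pi.single v' 1) = ratVec (x v') + w *ᵥ ratVec (S (c v')) := by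
      rw [hx v', ratVec_add, Matrix.mulVec_add, ratVec_mulVec, Matrix.mulVec_mulVec, ← hm, hwm,
        Matrix.one_mulVec]
    rw [h1, hx v, ratVec_add, add_dotProduct, h2, h3, dotProduct_add, ratVec_dotProduct]
    change _ + (ratVec (S (c v)) ⬝ᵥ _ + ratVec (S (c v)) ⬝ᵥ (w *ᵥ ratVec (S (c v')))) = _
    rw [hS, ratVec_dotProduct]
    push_cast
    ring
  have has : a.IsSymm := by
    ext i j
    have := hws.apply (σ i) (σ j)
    rwa [hwσ, hwσ] at this
  refine ⟨w, fun v => ∑ i, c v i • e i, h.tree, hmw, hws, ?_, ?_, ?_⟩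
  · intro v v'
    rw [pairing_sum_zsmul (w := a) hb, hwv, AddCircle.coe_add,
      ExtendedQuadraticForm.coe_int_eq_zero, zero_add]
  · intro v
    rw [refinement_sum_zsmul hq has hb hqe, hwv, add_div, AddCircle.coe_add]
    -- For `q` the integral correction has to be even, not just integral: it equals `xᵀ M x` plus
    -- twice an integer, where `x` stands for `x v`.
    have h1 : Even (x v ⬝ᵥ Pi.single v 1 + S (c v) ⬝ᵥ x v) := by
      rw [hx v, dotProduct_add, dotProduct_comm (S (c v)), add_assoc]
      exact (h.tree.even_dotProduct _).add ⟨_, rfl⟩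
    obtain ⟨k, hk⟩ := h1
    rw [hk, show (((k + k : ℤ) : ℚ) / 2) = k by push_cast; ring,
      ExtendedQuadraticForm.coe_int_eq_zero, zero_add]
  · refine le_antisymm (Submodule.span_le.2 ?_) (Submodule.span_le.2 ?_)
    · rintro _ ⟨v, rfl⟩
      exact Submodule.sum_mem _ fun i _ => Submodule.smul_mem _ _ (Submodule.subset_span ⟨i, rfl⟩)
    · rintro _ ⟨i, rfl⟩
      refine Submodule.subset_span ⟨σ i, ?_⟩
      simp [hc (σ i) i rfl, Pi.single_apply, ite_smul]

end

/-! ### Orthogonal sums along an edge at a neutral vertex. -/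

section
variable {V W : Type} [Fintype V] [Fintype W] [DecidableEq V] [DecidableEq W]
  {G : Type*} [AddCommGroup G]

theorem zsmul_coe_addCircle (n : ℤ) (x : ℚ) :
    n • (x : AddCircle (1 : ℚ)) = ((n * x : ℚ) : AddCircle (1 : ℚ)) := by
  rw [← AddCircle.coe_zsmul, zsmul_eq_mul]

theorem refinement_zsmul {b : G →+ G →+ AddCircle (1 : ℚ)} {q : G → AddCircle (1 : ℚ)}
    (hq : ∀ x y, q (x + y) - q x - q y = b x y) {x : G} {w : ℚ}
    (hb : b x x = (w : AddCircle (1 : ℚ))) (hx : q x = ((w / 2 : ℚ) : AddCircle (1 : ℚ))) (n : ℤ) :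
    q (n • x) = ((n * n * w / 2 : ℚ) : AddCircle (1 : ℚ)) := by
  have := refinement_sum_zsmul hq (h := fun _ : Unit => x) (w := Matrix.of fun _ _ => w)
    (by ext; rfl) (fun _ _ => hb) (fun _ => hx) (fun _ => n)
  simp only [Finset.univ_unique, Finset.sum_singleton] at this
  rw [this]
  congr 1
  simp [dotProduct, Matrix.mulVec]
  ring

/-- The column `r` of `w` is the integral vector `u`, and `u r = 0`. -/
def IsNeutral (w : Matrix V V ℚ) (r : V) (u : V → ℤ) : Prop :=
  w.col r = ratVec u ∧ u r = 0

/-- As `N u = e_{r'}` and `u r' = 0`, replacing the basis vector `e_r` by `e_r - u` removes its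
pairing with the second summand and changes no pairing within the first. So the joined form is
isomorphic to the orthogonal sum. -/
theorem IsRealization.link {b : G →+ G →+ AddCircle (1 : ℚ)} {q : G → AddCircle (1 : ℚ)}
    (hq : ∀ x y, q (x + y) - q x - q y = b x y) (hbs : ∀ x y, b x y = b y x)
    {K L : Submodule ℤ G} {M : Matrix V V ℤ} {N : Matrix W W ℤ} {w : Matrix V V ℚ}
    {w' : Matrix W W ℚ} {g : V → G} {g' : W → G} (hM : IsRealization b q K M w g)
    (hN : IsRealization b q L N w' g') (hKL : ∀ x ∈ K, ∀ y ∈ L, b x y = 0) (r : V) {r' : W}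
    {u : W → ℤ} (hu : IsNeutral w' r' u) :
    ∃ (w'' : Matrix (V ⊕ W) (V ⊕ W) ℚ) (g'' : V ⊕ W → G),
      IsRealization b q (K ⊔ L) (linkMatrix M N r r') w'' g'' ∧
        IsNeutral w'' (Sum.inr r') (Sum.elim 0 u) := by
  have hrow : ∀ j, w' r' j = u j := by
    intro j
    rw [← hN.isSymm.apply]
    exact congrFun hu.1 j
  have hgK : ∀ v, g v ∈ K := fun v => hM.span_eq ▸ Submodule.subset_span ⟨v, rfl⟩
  have hgL : ∀ v, g' v ∈ L := fun v => hN.span_eq ▸ Submodule.subset_span ⟨v, rfl⟩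
  have hcross : ∀ v v', b (g v) (g' v') = 0 := fun v v' => hKL _ (hgK v) _ (hgL v')
  -- The inverse and the elements of `G` obtained from the orthogonal sum by the dual change of
  -- basis, which turns `g' v` into `g' v - u v • g r`.
  refine ⟨Matrix.fromBlocks w (-vecMulVec (w.col r) (ratVec u)) (-vecMulVec (ratVec u) (w.col r))
    (w' + w r r • vecMulVec (ratVec u) (ratVec u)), Sum.elim g fun v => g' v - u v • g r,
    ⟨hM.tree.link hN.tree r r', ?_, ?_, ?_, ?_, ?_⟩, ?_, ?_⟩
  · have e1 : M.map (Int.cast : ℤ → ℚ) *ᵥ w.col r = Pi.single r 1 := by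
      rw [← Matrix.mulVec_single_one, Matrix.mulVec_mulVec, hM.mul_eq_one, Matrix.one_mulVec]
    have e2 : N.map (Int.cast : ℤ → ℚ) *ᵥ ratVec u = Pi.single r' 1 := by
      rw [← hu.1, ← Matrix.mulVec_single_one, Matrix.mulVec_mulVec, hN.mul_eq_one,
        Matrix.one_mulVec]
    have e3 : Pi.single r' 1 ᵥ* w' = ratVec u := by
      ext j
      simp [hrow]
    have e4 : Pi.single r 1 ᵥ* w = w.col r := by
      ext j
      simp [hM.isSymm.apply]
    rw [linkMatrix, Matrix.fromBlocks_map, Matrix.fromBlocks_multiply, ← Matrix.fromBlocks_one]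
    have e5 : (Matrix.single r r' (1 : ℤ)).map (Int.cast : ℤ → ℚ) =
        vecMulVec (Pi.single r 1) (Pi.single r' 1) := by
      ext i j
      simp [Matrix.single_apply, vecMulVec_apply, Pi.single_apply]
      grind
    have e6 : (Matrix.single r' r (1 : ℤ)).map (Int.cast : ℤ → ℚ) =
        vecMulVec (Pi.single r' 1) (Pi.single r 1) := by
      ext i j
      simp [Matrix.single_apply, vecMulVec_apply, Pi.single_apply]
      grind
    rw [e5, e6, hM.mul_eq_one]
    congr 1
    · ext i j
      simp [Matrix.mul_neg, Matrix.mul_vecMulVec, Matrix.vecMulVec_mulVec, hu.2]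
    · rw [Matrix.mul_neg, Matrix.mul_vecMulVec, e1, Matrix.vecMulVec_mul, Matrix.vecMul_add, e3]
      ext i j
      simp [vecMulVec_apply, hu.2]
    · rw [Matrix.mul_neg, Matrix.mul_vecMulVec, e2, Matrix.vecMulVec_mul, e4]
      simp
    · rw [Matrix.mul_neg, Matrix.mul_add, hN.mul_eq_one, Matrix.mul_smul, Matrix.mul_vecMulVec,
        Matrix.mul_vecMulVec, e2, Matrix.vecMulVec_mulVec]
      ext i j
      simp [vecMulVec_apply]
  · rw [Matrix.IsSymm, Matrix.fromBlocks_transpose, hM.isSymm.eq, Matrix.transpose_neg,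
      Matrix.transpose_neg, Matrix.transpose_add, hN.isSymm.eq, Matrix.transpose_smul]
    simp [Matrix.transpose_vecMulVec]
  · rintro (i | i) (j | j)
    · exact hM.b_eq i j
    · simp [hcross, hM.b_eq, vecMulVec_apply]
      rw [zsmul_coe_addCircle, mul_comm]
    · simp [hbs _ (g j), hcross, hM.b_eq, vecMulVec_apply,
        hM.isSymm.apply]
    · simp [hbs _ (g r), hcross, hM.b_eq, hN.b_eq, vecMulVec_apply]
      rw [zsmul_coe_addCircle, zsmul_coe_addCircle]
      congr 1
      ring
  · rintro (i | i)
    · exact hM.q_eq i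
    · have h1 := hq (g' i) (-u i • g r)
      rw [refinement_zsmul hq (hM.b_eq r r) (hM.q_eq r), map_zsmul, hbs _ (g r), hcross, smul_zero,
        sub_eq_zero, sub_eq_iff_eq_add, neg_smul, ← sub_eq_add_neg, hN.q_eq,
        ← AddCircle.coe_add] at h1
      simp only [Sum.elim_inr, h1]
      congr 1
      simp [vecMulVec_apply]
      ring
  · rw [← hM.span_eq, ← hN.span_eq]
    refine le_antisymm (Submodule.span_le.2 ?_) (sup_le (Submodule.span_le.2 ?_)
      (Submodule.span_le.2 ?_))
    · rintro _ ⟨i | i, rfl⟩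
      · exact Submodule.mem_sup_left (Submodule.subset_span ⟨i, rfl⟩)
      · exact Submodule.sub_mem _ (Submodule.mem_sup_right (Submodule.subset_span ⟨i, rfl⟩))
          (Submodule.smul_mem _ _ (Submodule.mem_sup_left (Submodule.subset_span ⟨r, rfl⟩)))
    · rintro _ ⟨i, rfl⟩
      exact Submodule.subset_span ⟨Sum.inl i, rfl⟩
    · rintro _ ⟨i, rfl⟩
      have := Submodule.add_mem (Submodule.span ℤ (Set.range (Sum.elim g fun v => g' v - u v • g r)))
        (Submodule.subset_span ⟨Sum.inr i, rfl⟩)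
        (Submodule.smul_mem _ (u i) (Submodule.subset_span ⟨Sum.inl r, rfl⟩))
      simpa using this
  · ext (i | i)
    · simp [vecMulVec_apply, hu.2]
    · have := congrFun hu.1 i
      simpa [vecMulVec_apply, hu.2] using this
  · simpa using hu.2

/-- The hyperbolic plane realizes the trivial group. -/
theorem exists_isRealization_bot (b : G →+ G →+ AddCircle (1 : ℚ)) {q : G → AddCircle (1 : ℚ)}
    (hq : q 0 = 0) : ∃ w g u, IsRealization b q ⊥
      (linkMatrix (Matrix.of fun _ _ : Unit => (0 : ℤ)) (Matrix.of fun _ _ : Unit => (0 : ℤ)) () ())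
      w g ∧ IsNeutral w (Sum.inl ()) u := by
  refine ⟨Matrix.of fun i j => if i = j then 0 else 1, 0, fun i => if i = Sum.inl () then 0 else 1,
    ⟨(isEvenTreeMatrix_unit (by simp)).link (isEvenTreeMatrix_unit (by simp)) () (), ?_, ?_, ?_,
      ?_, ?_⟩, ?_, rfl⟩
  · ext (i | i) (j | j) <;>
      simp [linkMatrix, Matrix.mul_apply]
  · ext i j
    simp [eq_comm]
  · intro i j
    simp only [Matrix.of_apply]
    split_ifs
    · simp
    · simpa using (ExtendedQuadraticForm.coe_int_eq_zero 1).symm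
  · simp [hq]
  · simp
  · ext (i | i) <;> simp

end

/-! ### Fractions modulo the integers. -/

theorem coe_intCast_div_eq_zero_iff {n : ℤ} (hn : n ≠ 0) (j : ℤ) :
    ((j / n : ℚ) : AddCircle (1 : ℚ)) = 0 ↔ n ∣ j := by
  have hn' : (n : ℚ) ≠ 0 := by exact_mod_cast hn
  rw [AddCircle.coe_eq_zero_iff]
  constructor
  · rintro ⟨m, hm⟩
    refine ⟨m, ?_⟩
    rw [zsmul_one, eq_div_iff hn'] at hm
    rw [mul_comm]
    exact_mod_cast hm.symm
  · rintro ⟨m, rfl⟩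
    refine ⟨m, ?_⟩
    rw [zsmul_one]
    push_cast
    rw [mul_div_cancel_left₀ _ hn']

theorem coe_intCast_div_congr {n : ℤ} (hn : n ≠ 0) {i j : ℤ} (h : n ∣ i - j) :
    ((i / n : ℚ) : AddCircle (1 : ℚ)) = ((j / n : ℚ) : AddCircle (1 : ℚ)) := by
  rw [← sub_eq_zero, ← AddCircle.coe_sub, ← sub_div, ← Int.cast_sub]
  exact (coe_intCast_div_eq_zero_iff hn _).2 h

theorem exists_coe_intCast_div_eq {n : ℤ} (hn : n ≠ 0) {t : AddCircle (1 : ℚ)} (ht : n • t = 0) :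
    ∃ j : ℤ, t = ((j / n : ℚ) : AddCircle (1 : ℚ)) := by
  have hn' : (n : ℚ) ≠ 0 := by exact_mod_cast hn
  obtain ⟨r, rfl⟩ := QuotientAddGroup.mk_surjective t
  change n • (r : AddCircle (1 : ℚ)) = 0 at ht
  rw [zsmul_coe_addCircle, AddCircle.coe_eq_zero_iff] at ht
  obtain ⟨j, hj⟩ := ht
  refine ⟨j, ?_⟩
  rw [zsmul_one] at hj
  rw [hj, mul_div_cancel_left₀ _ hn']
theorem zsmul_coe_intCast_div (m j n : ℤ) :
    m • ((j / n : ℚ) : AddCircle (1 : ℚ)) = (((m * j : ℤ) / n : ℚ) : AddCircle (1 : ℚ)) := by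
  rw [zsmul_coe_addCircle]
  push_cast
  rw [mul_div_assoc]

theorem eq_zero_of_isCoprime_zsmul {A : Type*} [AddCommGroup A] {m n : ℤ} (h : IsCoprime m n)
    {t : A} (hm : m • t = 0) (hn : n • t = 0) : t = 0 := by
  obtain ⟨a, b, hab⟩ := h
  rw [← one_zsmul t, ← hab, add_zsmul, mul_zsmul, mul_zsmul, hm, hn]
  simp

/-! ### Cyclic summands and summands generated by a pair. -/

section
variable {G : Type*} [AddCommGroup G]

/-- The restriction of `(b, q)` to `K` is the boundary of the form of an even tree. -/
def IsRealizable (b : G →+ G →+ AddCircle (1 : ℚ)) (q : G → AddCircle (1 : ℚ))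
    (K : Submodule ℤ G) : Prop :=
  ∃ (V : Type) (_ : Fintype V) (_ : DecidableEq V) (M : Matrix V V ℤ) (w : Matrix V V ℚ)
    (g : V → G), IsRealization b q K M w g

/-- A realizable nonzero subgroup of `K` which is an orthogonal summand of `K`. -/
structure IsRealizableSummand (b : G →+ G →+ AddCircle (1 : ℚ)) (q : G → AddCircle (1 : ℚ))
    (K B : Submodule ℤ G) : Prop where
  le : B ≤ K
  realizable : IsRealizable b q B
  proj : ∀ z ∈ K, ∃ y ∈ B, ∀ x ∈ B, b (z - y) x = 0
  nonzero : ∃ x ∈ B, ∃ y ∈ B, b x y ≠ 0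

variable {b : G →+ G →+ AddCircle (1 : ℚ)} {q : G → AddCircle (1 : ℚ)}

theorem refinement_zero (hq : ∀ x y, q (x + y) - q x - q y = b x y) : q 0 = 0 := by
  simpa using hq 0 0

theorem pairing_self_eq (hq : ∀ x y, q (x + y) - q x - q y = b x y) (hneg : ∀ x, q x = q (-x))
    (x : G) : b x x = (2 : ℤ) • q x := by
  have h := hq x (-x)
  rw [add_neg_cancel, refinement_zero hq, ← hneg, map_neg] at h
  rw [two_zsmul, ← neg_inj, ← h]
  abel

/-- The hypothesis says that `b x x = m / p ^ (k + 1)` with `m` prime to `p`. Hence `b` is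
nonsingular on the span of `x`, which therefore splits off. -/
theorem exists_isRealizableSummand_cyclic (hq : ∀ x y, q (x + y) - q x - q y = b x y)
    (hneg : ∀ x, q x = q (-x)) {K : Submodule ℤ G} {p k : ℕ} (hp : p.Prime) {x : G} (hxK : x ∈ K)
    (hx : (p ^ (k + 1) : ℤ) • x = 0) (hb : (p ^ k : ℤ) • b x x ≠ 0) :
    ∃ B, IsRealizableSummand b q K B := by
  set n : ℤ := p ^ (k + 1) with hn
  have hp0 : (p : ℤ) ≠ 0 := by exact_mod_cast hp.ne_zero
  have hn0 : n ≠ 0 := pow_ne_zero _ hp0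
  have hn' : (n : ℚ) ≠ 0 := by exact_mod_cast hn0
  obtain ⟨m, hm⟩ : ∃ m : ℤ, q x = ((m / n / 2 : ℚ) : AddCircle (1 : ℚ)) := by
    have h1 : (n * 2) • q x = 0 := by
      rw [mul_zsmul, ← pairing_self_eq hq hneg, ← map_zsmul, hx, map_zero]
    obtain ⟨m, hm⟩ := exists_coe_intCast_div_eq (mul_ne_zero hn0 two_ne_zero) h1
    refine ⟨m, ?_⟩
    rw [hm, div_div]
    push_cast
    rfl
  have hbm : b x x = ((m / n : ℚ) : AddCircle (1 : ℚ)) := by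
    rw [pairing_self_eq hq hneg, hm, zsmul_coe_addCircle]
    congr 1
    push_cast
    ring
  have hcop : IsCoprime n m := by
    refine IsCoprime.pow_left ((Nat.prime_iff_prime_int.mp hp).coprime_iff_not_dvd.2 ?_)
    rintro ⟨m', rfl⟩
    apply hb
    rw [hbm, zsmul_coe_intCast_div, coe_intCast_div_eq_zero_iff hn0, hn]
    exact ⟨m', by ring⟩
  -- From `0 = q (n • x) = n * m / 2`; for odd `n` this is what forces `m` to be even.
  have heven : Even (n * m) := by
    have h1 := refinement_zsmul hq hbm hm n
    rw [hx, refinement_zero hq] at h1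
    rw [even_iff_two_dvd, ← coe_intCast_div_eq_zero_iff two_ne_zero, h1]
    congr 1
    push_cast
    field_simp
  obtain ⟨V, _, _, M, r, hM⟩ := exists_isRooted n m hcop heven
  obtain ⟨w, g, hg⟩ := (hM.isGeneratedTree hn0).exists_isRealization hq (fun _ => x)
    (fun _ _ => hbm) (fun _ => hm)
  rw [Set.range_const] at hg
  refine ⟨_, (Submodule.span_singleton_le_iff_mem _ _).2 hxK, ⟨V, _, _, M, w, g, hg⟩, ?_, ?_⟩
  · intro z _
    obtain ⟨j, hj⟩ := exists_coe_intCast_div_eq hn0 (t := b z x) (by rw [← map_zsmul, hx, map_zero])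
    obtain ⟨c, a, hca⟩ := hcop
    refine ⟨(j * a) • x, Submodule.smul_mem _ _ (Submodule.mem_span_singleton_self _), ?_⟩
    intro y hy
    obtain ⟨i, rfl⟩ := Submodule.mem_span_singleton.1 hy
    have h0 : b (z - (j * a) • x) x = 0 := by
      rw [map_sub, AddMonoidHom.sub_apply, map_zsmul, AddMonoidHom.zsmul_apply, hj, hbm,
        zsmul_coe_intCast_div, sub_eq_zero]
      exact coe_intCast_div_congr hn0 ⟨j * c, by linear_combination -j * hca⟩
    rw [map_zsmul, h0, smul_zero]
  · exact ⟨x, Submodule.mem_span_singleton_self _, x, Submodule.mem_span_singleton_self _,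
      fun h => hb (by rw [h, smul_zero])⟩

/-- With `n = 2 ^ (k + 1)`, the Gram matrix is `1 / n` times an integral matrix with even diagonal
and off-diagonal entries `1`. Its determinant is odd, so the pair splits off; scaling `y` by an odd
`t` matches it to the tree. -/
theorem exists_isRealizableSummand_pair (hq : ∀ x y, q (x + y) - q x - q y = b x y)
    (hbs : ∀ x y, b x y = b y x) (hneg : ∀ x, q x = q (-x)) {K : Submodule ℤ G} {k : ℕ} {x y : G}
    (hxK : x ∈ K) (hyK : y ∈ K) (hx : (2 ^ (k + 1) : ℤ) • x = 0) (hy : (2 ^ (k + 1) : ℤ) • y = 0)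
    (hbx : (2 ^ k : ℤ) • b x x = 0) (hby : (2 ^ k : ℤ) • b y y = 0)
    (hb : b x y = (((1 : ℤ) / (2 ^ (k + 1) : ℤ) : ℚ) : AddCircle (1 : ℚ))) :
    ∃ B, IsRealizableSummand b q K B := by
  have hquot : ∀ z, (2 ^ k : ℤ) • b z z = 0 → ∃ a : ℤ,
      q z = ((a / (2 ^ (k + 1) : ℤ) : ℚ) : AddCircle (1 : ℚ)) := by
    intro z hz
    apply exists_coe_intCast_div_eq (by positivity)
    rw [pow_succ, mul_zsmul, ← pairing_self_eq hq hneg, hz]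
  obtain ⟨a, ha⟩ := hquot x hbx
  obtain ⟨c, hc⟩ := hquot y hby
  have hodd : ∀ m : ℤ, Odd m → IsCoprime m (2 ^ (k + 1)) := by
    rintro m ⟨j, rfl⟩
    exact IsCoprime.pow_right ⟨1, -j, by ring⟩
  have heven : Even (2 ^ (k + 1) : ℤ) := by
    rw [pow_succ]
    exact even_two.mul_left _
  set n : ℤ := 2 ^ (k + 1) with hn
  have hn0 : n ≠ 0 := by positivity
  have hbxx : b x x = (((2 * a : ℤ) / n : ℚ) : AddCircle (1 : ℚ)) := by
    rw [pairing_self_eq hq hneg, ha, zsmul_coe_intCast_div]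
  have hbyy : b y y = (((2 * c : ℤ) / n : ℚ) : AddCircle (1 : ℚ)) := by
    rw [pairing_self_eq hq hneg, hc, zsmul_coe_intCast_div]
  -- The tree, with its parameter `d` replaced by `2 * d`, must fit `x` and `t • y`: `g + 1 = 2 * a`
  -- and `t * c ≡ d` modulo `n`. As `t = 2 * g * d - 1`, the latter reads `d * (2 * g * c - 1) ≡ c`,
  -- so `d` is `c` times the inverse `s` of an odd number.
  obtain ⟨g, hg⟩ : ∃ g, g = 2 * a - 1 := ⟨_, rfl⟩
  obtain ⟨s, l, hsl⟩ := hodd (2 * (g * c) - 1) ⟨g * c - 1, by ring⟩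
  obtain ⟨d, hd⟩ : ∃ d, d = s * c := ⟨_, rfl⟩
  obtain ⟨t, ht⟩ : ∃ t, t = g * (2 * d) - 1 := ⟨_, rfl⟩
  have htodd : Odd t := ⟨g * d - 1, by rw [ht]; ring⟩
  have htc : n ∣ t * c - d := ⟨-(l * c), by rw [ht, hd]; linear_combination c * hsl⟩
  obtain ⟨V, _, _, M, v, hM⟩ := exists_isRooted (2 * d + 1) n (hodd _ ⟨d, rfl⟩) (heven.mul_left _)
  obtain ⟨W, _, _, N, v', hN⟩ := exists_isRooted (n * g) t
    ((hodd t htodd).symm.mul_left ⟨2 * d, -1, by rw [ht]; ring⟩) (by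
      rw [mul_assoc]
      exact heven.mul_right _)
  have hqt : q (t • y) = (((t * t * c : ℤ) / n : ℚ) : AddCircle (1 : ℚ)) := by
    rw [refinement_zsmul hq hbyy (by rw [hc]; congr 1; push_cast; ring)]
    congr 1
    push_cast
    ring
  obtain ⟨w, g', hg'⟩ := (hM.isGeneratedTree_pair hn0 heven ht hN).exists_isRealization hq
    ![x, t • y] (by
      rw [Fin.forall_fin_two, Fin.forall_fin_two, Fin.forall_fin_two]
      refine ⟨⟨?_, ?_⟩, ⟨?_, ?_⟩⟩
      · simp only [Matrix.cons_val_zero, hbxx, hg]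
        congr 3
        ring
      · simp only [Matrix.cons_val_zero, Matrix.cons_val_one, map_zsmul, hb, zsmul_coe_intCast_div,
          mul_one]
      · simp only [Matrix.cons_val_zero, Matrix.cons_val_one, map_zsmul, AddMonoidHom.zsmul_apply,
          hbs y x, hb, zsmul_coe_intCast_div, mul_one]
      · simp only [Matrix.cons_val_zero, Matrix.cons_val_one, map_zsmul, AddMonoidHom.zsmul_apply, hbyy,
          zsmul_coe_intCast_div]
        refine coe_intCast_div_congr hn0 ?_
        obtain ⟨e, he⟩ := htc
        exact ⟨2 * t * e, by linear_combination 2 * t * he⟩) (by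
      rw [Fin.forall_fin_two]
      constructor
      · simp only [Matrix.cons_val_zero, ha, hg]
        congr 1
        push_cast
        ring
      · simp only [Matrix.cons_val_zero, Matrix.cons_val_one, hqt]
        have : ((2 * d * t : ℤ) / n / 2 : ℚ) = ((t * d : ℤ) / n : ℚ) := by
          push_cast
          ring
        rw [this]
        refine coe_intCast_div_congr hn0 ?_
        obtain ⟨e, he⟩ := htc
        exact ⟨t * e, by linear_combination t * he⟩)
  set B := Submodule.span ℤ (Set.range ![x, t • y]) with hB
  have hxB : x ∈ B := Submodule.subset_span ⟨0, rfl⟩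
  have htyB : t • y ∈ B := Submodule.subset_span ⟨1, rfl⟩
  have hyB : y ∈ B := by
    obtain ⟨e, f, hef⟩ := hodd t htodd
    have : y = e • t • y := by
      conv_lhs => rw [← one_zsmul y, ← hef, add_zsmul, mul_zsmul, mul_zsmul, hy, smul_zero, add_zero]
    rw [this]
    exact Submodule.smul_mem _ _ htyB
  refine ⟨B, ?_, ⟨_, _, _, _, w, g', hg'⟩, ?_, x, hxB, y, hyB, ?_⟩
  · rw [hB, Submodule.span_le]
    rintro _ ⟨i, rfl⟩
    revert i
    rw [Fin.forall_fin_two]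
    exact ⟨hxK, Submodule.smul_mem _ _ hyK⟩
  · intro z _
    obtain ⟨i, hi⟩ := exists_coe_intCast_div_eq hn0 (t := b z x) (by rw [← map_zsmul, hx, map_zero])
    obtain ⟨j, hj⟩ := exists_coe_intCast_div_eq hn0 (t := b z y) (by rw [← map_zsmul, hy, map_zero])
    -- Projecting `z` solves a two-by-two system of determinant `4 * a * c - 1` modulo `n`; `e`
    -- inverts its negative.
    obtain ⟨e, f, hef⟩ := hodd (1 - 4 * (a * c)) ⟨-2 * (a * c), by ring⟩
    obtain ⟨α, hα⟩ : ∃ α, α = e * (j - 2 * c * i) := ⟨_, rfl⟩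
    refine ⟨α • x + (i - 2 * a * α) • y, Submodule.add_mem _ (Submodule.smul_mem _ _ hxB)
      (Submodule.smul_mem _ _ hyB), ?_⟩
    have h1 : b (z - (α • x + (i - 2 * a * α) • y)) x = 0 := by
      simp only [map_sub, map_add, AddMonoidHom.sub_apply, AddMonoidHom.add_apply, map_zsmul,
        AddMonoidHom.zsmul_apply, hi, hbxx, hbs y x, hb, zsmul_coe_intCast_div]
      rw [← AddCircle.coe_add, sub_eq_zero, ← add_div, ← Int.cast_add]
      exact coe_intCast_div_congr hn0 ⟨0, by ring⟩
    have h2 : b (z - (α • x + (i - 2 * a * α) • y)) y = 0 := by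
      simp only [map_sub, map_add, AddMonoidHom.sub_apply, AddMonoidHom.add_apply, map_zsmul,
        AddMonoidHom.zsmul_apply, hj, hbyy, hb, zsmul_coe_intCast_div]
      rw [← AddCircle.coe_add, sub_eq_zero, ← add_div, ← Int.cast_add]
      refine coe_intCast_div_congr hn0 ⟨f * (j - 2 * c * i), ?_⟩
      rw [hα]
      linear_combination -(j - 2 * c * i) * hef
    intro u hu
    refine Submodule.span_induction ?_ (map_zero _) ?_ ?_ hu
    · rintro _ ⟨i, rfl⟩
      revert i
      rw [Fin.forall_fin_two]
      refine ⟨h1, ?_⟩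
      simp only [Matrix.cons_val_zero, Matrix.cons_val_one, map_zsmul, h2, smul_zero]
    · intro u u' _ _ h h'
      rw [map_add, h, h', add_zero]
    · intro m u _ h
      rw [map_zsmul, h, smul_zero]
  · rw [hb, Ne, coe_intCast_div_eq_zero_iff hn0]
    intro h
    have := heven.two_dvd.trans h
    omega
end

/-! ### Orthogonal decomposition and realization of the whole group. -/

section
variable {G : Type*} [AddCommGroup G]
  {b : G →+ G →+ AddCircle (1 : ℚ)} {q : G → AddCircle (1 : ℚ)}

/-- Take a `p`-primary element whose order is the full power of `p` in the exponent of `K`.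
Nonsingularity detects its multiple by `p ^ k`. -/
theorem exists_pairing_of_prime_pow [Finite G] {K : Submodule ℤ G}
    (hK : ∀ x ∈ K, (∀ y ∈ K, b x y = 0) → x = 0) (hne : K ≠ ⊥) :
    ∃ (p k : ℕ) (x y : G), p.Prime ∧ x ∈ K ∧ y ∈ K ∧ (p ^ (k + 1) : ℤ) • x = 0 ∧
      (p ^ (k + 1) : ℤ) • y = 0 ∧ (p ^ k : ℤ) • b x y ≠ 0 := by
  have hnt : Nontrivial K := Submodule.nontrivial_iff_ne_bot.2 hne
  have he : AddMonoid.exponent K ≠ 0 := AddMonoid.exponent_ne_zero_of_finite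
  have he1 : AddMonoid.exponent K ≠ 1 := fun h =>
    not_subsingleton K (AddMonoid.exp_eq_one_iff.1 h)
  obtain ⟨p, hp, hpe⟩ := Nat.exists_prime_and_dvd he1
  obtain ⟨k, m, hpm, hkm⟩ := Nat.exists_eq_pow_mul_and_not_dvd he p hp.ne_one
  obtain ⟨k, rfl⟩ : ∃ l, k = l + 1 := by
    refine Nat.exists_eq_succ_of_ne_zero ?_
    rintro rfl
    rw [pow_zero, one_mul] at hkm
    exact hpm (hkm ▸ hpe)
  have hm0 : 0 < m := Nat.pos_of_ne_zero (by rintro rfl; exact hpm (dvd_zero p))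
  have hkill : ∀ x ∈ K, (p ^ (k + 1) : ℤ) • (m : ℤ) • x = 0 := by
    intro x hx
    have h := AddMonoid.exponent_nsmul_eq_zero (⟨x, hx⟩ : K)
    rw [hkm] at h
    have h' := congrArg Subtype.val h
    rw [← mul_zsmul, ← natCast_zsmul] at *
    simpa using h'
  -- Otherwise `p ^ k * m` would kill `K`, although the exponent is `p ^ (k + 1) * m`.
  obtain ⟨x, hx⟩ : ∃ x : K, (p ^ k * m) • x ≠ 0 := by
    by_contra! h
    have h1 := Nat.le_of_dvd (Nat.mul_pos (pow_pos hp.pos k) hm0)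
      (AddMonoid.exponent_dvd_of_forall_nsmul_eq_zero h)
    rw [hkm, pow_succ, mul_assoc] at h1
    have h2 := Nat.le_of_mul_le_mul_left h1 (pow_pos hp.pos k)
    nlinarith [hp.two_le]
  have hx' : (p ^ k : ℤ) • (m : ℤ) • (x : G) ≠ 0 := by
    intro h
    apply hx
    ext
    rw [← mul_zsmul] at h
    rw [← natCast_zsmul]
    simpa using h
  obtain ⟨y, hy, hxy⟩ : ∃ y ∈ K, b ((p ^ k : ℤ) • (m : ℤ) • (x : G)) y ≠ 0 := by
    by_contra! h
    exact hx' (hK _ (K.smul_mem _ (K.smul_mem _ x.2)) h)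
  refine ⟨p, k, (m : ℤ) • (x : G), (m : ℤ) • y, hp, K.smul_mem _ x.2, K.smul_mem _ hy,
    hkill _ x.2, hkill _ hy, fun h => hxy ?_⟩
  have hcop : IsCoprime (p : ℤ) (m : ℤ) :=
    (Nat.prime_iff_prime_int.mp hp).coprime_iff_not_dvd.2 (by exact_mod_cast hpm)
  refine eq_zero_of_isCoprime_zsmul hcop ?_ ?_
  · rw [← AddMonoidHom.zsmul_apply, ← map_zsmul, ← mul_zsmul, ← pow_succ', hkill _ x.2]
    simp
  · rw [← h, map_zsmul b, AddMonoidHom.zsmul_apply, map_zsmul _ (m : ℤ) y, zsmul_comm]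

theorem exists_isRealizableSummand [Finite G] (hq : ∀ x y, q (x + y) - q x - q y = b x y)
    (hbs : ∀ x y, b x y = b y x) (hneg : ∀ x, q x = q (-x)) {K : Submodule ℤ G}
    (hK : ∀ x ∈ K, (∀ y ∈ K, b x y = 0) → x = 0) (hne : K ≠ ⊥) :
    ∃ B, IsRealizableSummand b q K B := by
  obtain ⟨p, k, x, y, hp, hxK, hyK, hx, hy, hb⟩ := exists_pairing_of_prime_pow hK hne
  by_cases hbx : (p ^ k : ℤ) • b x x = 0
  swap
  · exact exists_isRealizableSummand_cyclic hq hneg hp hxK hx hbx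
  by_cases hby : (p ^ k : ℤ) • b y y = 0
  swap
  · exact exists_isRealizableSummand_cyclic hq hneg hp hyK hy hby
  by_cases hp2 : p = 2
  · subst hp2
    push_cast at *
    have hn0 : (2 ^ (k + 1) : ℤ) ≠ 0 := by positivity
    obtain ⟨j, hj⟩ := exists_coe_intCast_div_eq hn0 (t := b x y) (by
      rw [← map_zsmul, hy, map_zero])
    have hjo : IsCoprime j (2 ^ (k + 1)) := by
      refine IsCoprime.pow_right ((Int.prime_two.coprime_iff_not_dvd).2 ?_).symm
      rintro ⟨i, rfl⟩
      apply hb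
      rw [hj, zsmul_coe_intCast_div, coe_intCast_div_eq_zero_iff hn0]
      exact ⟨i, by ring⟩
    obtain ⟨e, f, hef⟩ := hjo
    refine exists_isRealizableSummand_pair hq hbs hneg hxK (K.smul_mem e hyK) hx
      (by rw [zsmul_comm, hy, smul_zero]) hbx ?_ ?_
    · rw [map_zsmul, map_zsmul, AddMonoidHom.zsmul_apply, zsmul_comm, zsmul_comm _ e, hby]
      simp
    · rw [map_zsmul, hj, zsmul_coe_intCast_div]
      exact coe_intCast_div_congr hn0 ⟨-f, by linear_combination hef⟩
  -- For odd `p` the sum `x + y` works: its self-pairing, multiplied by `p ^ k`, is twice `p ^ k • b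
  -- x y`, and 2 is invertible.
  · refine exists_isRealizableSummand_cyclic hq hneg hp (K.add_mem hxK hyK)
      (by rw [smul_add, hx, hy, add_zero]) (k := k) fun h => hb ?_
    simp only [map_add, AddMonoidHom.add_apply, hbs y x, smul_add, hbx, hby, zero_add,
      add_zero] at h
    refine eq_zero_of_isCoprime_zsmul (m := 2) (n := p) ?_ (by rw [two_zsmul, h]) ?_
    · exact_mod_cast (Nat.coprime_primes Nat.prime_two hp).2 (Ne.symm hp2)
    · rw [← mul_zsmul, ← pow_succ', ← map_zsmul, hy, map_zero]

/-- Every nonsingular subgroup is realized by a tree with a neutral vertex. -/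
theorem exists_isRealization_isNeutral [Finite G] (hq : ∀ x y, q (x + y) - q x - q y = b x y)
    (hbs : ∀ x y, b x y = b y x) (hneg : ∀ x, q x = q (-x)) (K : Submodule ℤ G)
    (hK : ∀ x ∈ K, (∀ y ∈ K, b x y = 0) → x = 0) :
    ∃ (V : Type) (_ : Fintype V) (_ : DecidableEq V) (M : Matrix V V ℤ) (w : Matrix V V ℚ)
      (g : V → G) (r : V) (u : V → ℤ), IsRealization b q K M w g ∧ IsNeutral w r u := by
  induction K using WellFoundedLT.induction with
  | _ K ih =>
  by_cases hne : K = ⊥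
  · subst hne
    obtain ⟨w, g, u, h⟩ := exists_isRealization_bot b (refinement_zero hq)
    exact ⟨_, _, _, _, w, g, _, u, h⟩
  obtain ⟨B, hBK, ⟨V, _, _, M, w, g, hg⟩, hproj, x, hxB, y, hyB, hxy⟩ :=
    exists_isRealizableSummand hq hbs hneg hK hne
  let P : Submodule ℤ G := AddSubgroup.toIntSubmodule
    { carrier := {z | ∀ x ∈ B, b z x = 0}
      add_mem' := by
        intro z z' h h' x hx
        rw [map_add, AddMonoidHom.add_apply, h x hx, h' x hx, add_zero]
      zero_mem' := by
        intro x _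
        simp
      neg_mem' := by
        intro z h x hx
        rw [map_neg, AddMonoidHom.neg_apply, h x hx, neg_zero] }
  have hP : ∀ z, z ∈ P ↔ ∀ x ∈ B, b z x = 0 := fun z => Iff.rfl
  have hsup : B ⊔ K ⊓ P = K := by
    refine le_antisymm (sup_le hBK inf_le_left) fun z hz => ?_
    obtain ⟨y, hy, h⟩ := hproj z hz
    rw [← add_sub_cancel y z]
    exact Submodule.add_mem_sup hy ⟨K.sub_mem hz (hBK hy), (hP _).2 h⟩
  obtain ⟨V', _, _, N, w', g', r, u, hg', hu⟩ := ih (K ⊓ P)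
    (lt_of_le_of_ne inf_le_left fun h => hxy ((hP x).1 (inf_eq_left.1 h (hBK hxB)) y hyB)) (by
      -- An element of the complement orthogonal to the complement is also orthogonal to `B`, hence
      -- to all of `K`.
      rintro z ⟨hz, hzP⟩ h
      refine hK z hz fun t ht => ?_
      rw [← hsup] at ht
      obtain ⟨s, hs, s', hs', rfl⟩ := Submodule.mem_sup.1 ht
      rw [map_add, (hP z).1 hzP s hs, h s' hs', add_zero])
  obtain ⟨v⟩ : Nonempty V := by
    obtain ⟨Γ, hΓ, -⟩ := hg.tree
    exact hΓ.connected.nonempty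
  obtain ⟨w'', g'', h⟩ := hg.link hq hbs hg' (fun s hs t ht => by
    rw [hbs]
    exact (hP t).1 ht.2 s hs) v hu
  rw [hsup] at h
  exact ⟨_, _, _, _, w'', g'', _, _, h⟩

end

/-! ### The boundary of the form of an even tree. -/

namespace ExtendedQuadraticForm

section boundary
variable {k : ℕ} {H : Type*} [AddCommGroup H] [Module.Free ℤ H] [Module.Finite ℤ H]

/-- The cokernel is finite, so a nonzero multiple of `x` lies in the image of the adjoint, where
`hB` fixes the value. -/
theorem inverseForm_unique (F : ExtendedQuadraticForm k H) (hF : F.IsNondegenerate)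
    (B : Module.Dual ℤ H → Module.Dual ℤ H → ℚ) (hn : ∀ (n : ℕ) x y, B (n • x) y = n * B x y)
    (hB : ∀ h y, B (F.form h) y = y h) (x y : Module.Dual ℤ H) : F.inverseForm hF x y = B x y := by
  have := F.finite_coker hF
  have hmem : Nat.card F.Coker • x ∈ LinearMap.range F.form := by
    rw [← Submodule.Quotient.mk_eq_zero, Submodule.Quotient.mk_smul]
    exact card_nsmul_eq_zero'
  obtain ⟨h, hh⟩ := hmem
  have hc : (Nat.card F.Coker : ℚ) ≠ 0 := by exact_mod_cast Nat.card_pos.ne'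
  apply mul_left_cancel₀ hc
  rw [← hn, ← inverseForm_nsmul_left, ← hh, hB, inverseForm_form]

/-- Both sides are the radical of `λ⁻¹` modulo `ℤ` on `H^*`: one by nonsingularity of `Q`, the other
by nonsingularity of the boundary. -/
theorem ker_eq_range_form (F : ExtendedQuadraticForm k H) (hF : F.IsNondegenerate) {G : Type*}
    [AddCommGroup G] (Q : ExtendedQuadraticLinkingForm k G) (φ : Module.Dual ℤ H →ₗ[ℤ] G)
    (hφ : Function.Surjective φ)
    (hb : ∀ x y, Q.b (φ x) (φ y) = ((F.inverseForm hF x y : ℚ) : AddCircle (1 : ℚ))) :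
    LinearMap.ker φ = LinearMap.range F.form := by
  ext x
  rw [LinearMap.mem_ker]
  constructor
  · intro hx
    rw [← Submodule.Quotient.mk_eq_zero]
    refine F.boundaryLinking_nonsingular hF _ fun y => ?_
    obtain ⟨y, rfl⟩ := Submodule.Quotient.mk_surjective _ y
    rw [boundaryLinking_mk, ← hb, hx, map_zero, AddMonoidHom.zero_apply]
  · rintro ⟨h, rfl⟩
    refine Q.b_nonsingular _ fun y => ?_
    obtain ⟨y, rfl⟩ := hφ y
    rw [hb, inverseForm_form, coe_int_eq_zero]

theorem isomorphic_boundary (F : ExtendedQuadraticForm k H) (hF : F.IsNondegenerate) {G : Type*}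
    [AddCommGroup G] (Q : ExtendedQuadraticLinkingForm k G) (φ : Module.Dual ℤ H →ₗ[ℤ] G)
    (hφ : Function.Surjective φ)
    (hb : ∀ x y, Q.b (φ x) (φ y) = ((F.inverseForm hF x y : ℚ) : AddCircle (1 : ℚ)))
    (hq : ∀ x, Q.q (φ x) = F.refinement hF x)
    (hβ : LinearMap.rTensor (StableGroup k) φ
      ((dualTensorHomEquiv ℤ H (StableGroup k)).symm F.stable) = Q.β) :
    Q.Isomorphic (F.boundary hF) := by
  let E : F.Coker ≃ₗ[ℤ] G := (Submodule.quotEquivOfEq _ _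
    (F.ker_eq_range_form hF Q φ hφ hb).symm).trans (φ.quotKerEquivOfSurjective hφ)
  have hE : ∀ x, E (Submodule.Quotient.mk x) = φ x := fun x => rfl
  have hE' : ∀ x, E.symm (φ x) = Submodule.Quotient.mk x := by
    intro x
    rw [LinearEquiv.symm_apply_eq, hE]
  refine ⟨E.symm.toAddEquiv, ?_, ?_, ?_⟩
  · intro x y
    obtain ⟨x, rfl⟩ := hφ x
    obtain ⟨y, rfl⟩ := hφ y
    change F.boundaryLinking hF (E.symm (φ x)) (E.symm (φ y)) = _
    rw [hE', hE', boundaryLinking_mk, hb]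
  · intro x
    obtain ⟨x, rfl⟩ := hφ x
    change F.boundaryRefinement hF (E.symm (φ x)) = _
    rw [hE', boundaryRefinement_mk, hq]
  · rw [← hβ, ← LinearMap.comp_apply, ← LinearMap.rTensor_comp]
    change _ = F.boundaryStable
    rw [boundaryStable]
    congr 2
    ext x
    exact hE' x

end boundary

section tree
variable {k : ℕ} {V : Type} [Fintype V] [DecidableEq V] {M : Matrix V V ℤ}

/-- The extended quadratic form of an even tree matrix with a given even stable class. -/
noncomputable def ofEvenTree (hM : IsEvenTreeMatrix M) (α : (V → ℤ) →ₗ[ℤ] StableGroup k)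
    (hα : ∀ h : IsExceptional k, ∀ x, Even (stableGroupInt h (α x))) :
    ExtendedQuadraticForm k (V → ℤ) where
  form := Matrix.toLinearMap₂' ℤ M
  form_symm x y := by
    rw [Matrix.toLinearMap₂'_apply', Matrix.toLinearMap₂'_apply', dotProduct_comm,
      hM.mulVec_dotProduct]
  stable := α
  characteristic h x := by
    rw [Matrix.toLinearMap₂'_apply']
    have h1 := Int.even_iff.1 (hM.even_dotProduct x)
    have h2 := Int.even_iff.1 (hα h x)
    exact h1.trans h2.symm
  even _ x := by
    rw [Matrix.toLinearMap₂'_apply']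
    exact hM.even_dotProduct x

variable (hM : IsEvenTreeMatrix M) (α : (V → ℤ) →ₗ[ℤ] StableGroup k)
  (hα : ∀ h : IsExceptional k, ∀ x, Even (stableGroupInt h (α x)))

theorem ofEvenTree_form_apply (x y : V → ℤ) :
    (ofEvenTree hM α hα).form x y = x ⬝ᵥ (M *ᵥ y) :=
  Matrix.toLinearMap₂'_apply' M x y

theorem isTreelike_ofEvenTree : (ofEvenTree hM α hα).IsTreelike := by
  obtain ⟨Γ, hΓ, -, hadj⟩ := id hM
  let e := (Fintype.equivFin V).symm
  refine ⟨Fintype.card V, ⟨Γ.comap e, (SimpleGraph.Iso.comap e Γ).isTree_iff.2 hΓ,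
    fun i => M (e i) (e i)⟩, LinearEquiv.funCongrLeft ℤ ℤ e, fun x y => ?_⟩
  have hmat : LabelledTree.matrix ⟨Γ.comap e, (SimpleGraph.Iso.comap e Γ).isTree_iff.2 hΓ,
      fun i => M (e i) (e i)⟩ = M.submatrix e e := by
    ext i j
    simp only [LabelledTree.matrix, Matrix.of_apply, Matrix.submatrix_apply, SimpleGraph.comap_adj]
    by_cases hij : i = j
    · simp [hij]
    · have := hadj (e i) (e j) (e.injective.ne hij)
      by_cases a : Γ.Adj (e i) (e j)
      · simp [hij, a, this.1 a]
      · simp [hij, a, this.2 a]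
  rw [LabelledTree.form, Matrix.toLinearMap₂'_apply', hmat, ofEvenTree_form_apply]
  change (x ∘ e) ⬝ᵥ (M.submatrix e e *ᵥ (y ∘ e)) = _
  rw [Matrix.submatrix_mulVec_equiv, Function.comp_assoc, Equiv.self_comp_symm, Function.comp_id,
    comp_equiv_dotProduct_comp_equiv]

theorem isNondegenerate_ofEvenTree {w : Matrix V V ℚ}
    (hw : M.map (Int.cast : ℤ → ℚ) * w = 1) : (ofEvenTree hM α hα).IsNondegenerate := by
  refine (injective_iff_map_eq_zero _).2 fun x hx => ?_
  have h1 : M *ᵥ x = 0 := by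
    ext i
    have := LinearMap.congr_fun hx (Pi.single i 1)
    rw [ofEvenTree_form_apply, ← hM.mulVec_dotProduct] at this
    simpa using this
  have h2 : w *ᵥ ratVec (M *ᵥ x) = ratVec x := by
    rw [ratVec_mulVec, Matrix.mulVec_mulVec, mul_eq_one_comm.1 hw, Matrix.one_mulVec]
  rw [h1] at h2
  ext i
  have := congrFun h2 i
  simpa [ratVec, Matrix.mulVec, dotProduct] using this.symm

theorem inverseForm_ofEvenTree {w : Matrix V V ℚ} (hw : M.map (Int.cast : ℤ → ℚ) * w = 1)
    (hF : (ofEvenTree hM α hα).IsNondegenerate) (x y : Module.Dual ℤ (V → ℤ)) :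
    (ofEvenTree hM α hα).inverseForm hF x y =
      ratVec (fun v => x (Pi.single v 1)) ⬝ᵥ (w *ᵥ ratVec fun v => y (Pi.single v 1)) := by
  refine inverseForm_unique _ hF (fun x y => ratVec (fun v => x (Pi.single v 1)) ⬝ᵥ
    (w *ᵥ ratVec fun v => y (Pi.single v 1))) ?_ ?_ x y
  · intro n x y
    have : ratVec (fun v => (n • x) (Pi.single v 1)) =
        (n : ℚ) • ratVec fun v => x (Pi.single v 1) := by
      ext v
      simp
    rw [this, smul_dotProduct, smul_eq_mul]
  · intro h y
    have h1 : (fun v => (ofEvenTree hM α hα).form h (Pi.single v 1)) = M *ᵥ h := by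
      ext v
      rw [ofEvenTree_form_apply, ← hM.mulVec_dotProduct]
      simp
    have h2 : y h = h ⬝ᵥ fun v => y (Pi.single v 1) := by
      conv_lhs => rw [pi_eq_sum_univ' h]
      simp only [map_sum, map_smul, smul_eq_mul, dotProduct]
    have hms : (M.map (Int.cast : ℤ → ℚ)).IsSymm := hM.isSymm.map _
    rw [h1, h2, ← ratVec_dotProduct, ratVec_mulVec, dotProduct_comm, Matrix.dotProduct_mulVec,
      ← Matrix.mulVec_transpose, hms.eq, Matrix.mulVec_mulVec, hw, Matrix.one_mulVec,
      dotProduct_comm]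

end tree
end ExtendedQuadraticForm

/-! ### Reduction to a homogeneous refinement and conclusion. -/

open ExtendedQuadraticForm

/-- A homogeneous refinement of the linking form and its difference with the given refinement. -/
theorem ExtendedQuadraticLinkingForm.exists_homogeneous {k : ℕ} {G : Type*} [AddCommGroup G]
    (Q : ExtendedQuadraticLinkingForm k G) : ∃ (g : G) (q : G → AddCircle (1 : ℚ)),
      (∀ x y, q (x + y) - q x - q y = Q.b x y) ∧ (∀ x, q x = q (-x)) ∧
      (∀ x, Q.q x = q x + Q.b x g) ∧ (¬ IsExceptional k → g = 0) ∧
      (IsExceptional k → Q.β = (2 • g) ⊗ₜ[ℤ] (1 : StableGroup k)) := by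
  by_cases h : IsExceptional k
  · obtain ⟨g, hβ, hd⟩ := Q.defect h
    refine ⟨g, fun x => Q.q x - Q.b x g, ?_, ?_, fun x => (sub_add_cancel _ _).symm,
      fun h' => absurd h h', fun _ => hβ⟩
    · intro x y
      simp only [← Q.q_refines, map_add, AddMonoidHom.add_apply]
      abel
    · intro x
      have := hd x
      rw [two_nsmul, map_add, sub_eq_iff_eq_add] at this
      simp only [this, map_neg, AddMonoidHom.neg_apply]
      abel
  · exact ⟨0, Q.q, Q.q_refines, Q.homogeneous h, by simp, fun _ => rfl, fun h' => absurd h' h⟩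

theorem mainTheorem6 (k : ℕ) (hk : 2 ≤ k) {G : Type*} [AddCommGroup G]
    (Q : ExtendedQuadraticLinkingForm k G) :
    ∃ (H : Type) (_ : AddCommGroup H) (_ : Module.Free ℤ H) (_ : Module.Finite ℤ H)
      (F : ExtendedQuadraticForm k H) (hF : F.IsNondegenerate),
      F.IsTreelike ∧ Q.Isomorphic (F.boundary hF) := by
  have := Q.finite
  obtain ⟨g₀, q, hq, hneg, hQq, hg₀, hβ⟩ := Q.exists_homogeneous
  obtain ⟨V, _, _, M, w, g, -, -, hg, -⟩ := exists_isRealization_isNeutral hq Q.b_symm hneg ⊤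
    fun x _ h => Q.b_nonsingular x fun y => h y trivial
  let φ : Module.Dual ℤ (V → ℤ) →ₗ[ℤ] G :=
    ∑ v, (LinearMap.applyₗ (Pi.single v 1 : V → ℤ)).smulRight (g v)
  have hφ_apply : ∀ x, φ x = ∑ v, x (Pi.single v 1) • g v := by
    intro x
    simp [φ]
  have hφ : Function.Surjective φ := by
    intro z
    have hz : z ∈ Submodule.span ℤ (Set.range g) := hg.span_eq ▸ trivial
    obtain ⟨c, rfl⟩ := (Submodule.mem_span_range_iff_exists_fun ℤ).1 hz
    refine ⟨∑ v, c v • LinearMap.proj v, ?_⟩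
    rw [hφ_apply]
    refine Finset.sum_congr rfl fun v _ => ?_
    congr 1
    simp [Pi.single_apply]
  -- For `k = 2, 4` an arbitrary lift of `β` would not do: the lift has to be twice a lift of `g₀`,
  -- to be even and to correct `q` by `b(·, g₀)`.
  obtain ⟨ξ, hξ, a, ha, hξa⟩ : ∃ ξ : Module.Dual ℤ (V → ℤ) ⊗[ℤ] StableGroup k,
      LinearMap.rTensor (StableGroup k) φ ξ = Q.β ∧ ∃ a, φ a = g₀ ∧
        (IsExceptional k → ξ = (2 • a) ⊗ₜ[ℤ] (1 : StableGroup k)) := by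
    obtain ⟨a, ha⟩ := hφ g₀
    by_cases h : IsExceptional k
    · refine ⟨_, ?_, a, ha, fun _ => rfl⟩
      rw [LinearMap.rTensor_tmul, map_nsmul, ha, hβ h]
    · obtain ⟨ξ, hξ⟩ := LinearMap.rTensor_surjective (StableGroup k) hφ Q.β
      exact ⟨ξ, hξ, a, ha, fun h' => absurd h' h⟩
  let α := dualTensorHomEquiv ℤ (V → ℤ) (StableGroup k) ξ
  have hα : ∀ (h : IsExceptional k) x, stableGroupInt h (α x) = (2 • a) x := by
    intro h x
    simp only [α, hξa h, dualTensorHomEquiv, LinearEquiv.ofBijective_apply, dualTensorHom_apply]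
    simp [map_ofNat]
  have hα2 : ∀ h : IsExceptional k, ∀ x, Even (stableGroupInt h (α x)) := by
    intro h x
    rw [hα, LinearMap.smul_apply, nsmul_eq_mul]
    exact even_two.mul_right _
  let F := ofEvenTree hg.tree α hα2
  have hF : F.IsNondegenerate := isNondegenerate_ofEvenTree _ _ _ hg.mul_eq_one
  have hinv := inverseForm_ofEvenTree hg.tree α hα2 hg.mul_eq_one hF
  have hb : ∀ x y, Q.b (φ x) (φ y) = ((F.inverseForm hF x y : ℚ) : AddCircle (1 : ℚ)) := by
    intro x y
    rw [hφ_apply, hφ_apply, pairing_sum_zsmul hg.b_eq, hinv]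
  have hqφ : ∀ x, q (φ x) = ((F.inverseForm hF x x / 2 : ℚ) : AddCircle (1 : ℚ)) := by
    intro x
    rw [hφ_apply, refinement_sum_zsmul hq hg.isSymm hg.b_eq hg.q_eq, hinv]
  refine ⟨V → ℤ, inferInstance, inferInstance, inferInstance, F, hF,
    isTreelike_ofEvenTree _ _ _, isomorphic_boundary F hF Q φ hφ hb ?_ ?_⟩
  · intro x
    rw [hQq, hqφ, refinement]
    split_ifs with h
    · have h1 : F.stableDual h = a + a := by
        ext v
        rw [← two_nsmul]
        exact hα h _
      rw [← ha, hb, h1, inverseForm_add_right, ← AddCircle.coe_add]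
      congr 1
      ring
    · rw [hg₀ h, map_zero, add_zero]
  · rw [← hξ]
    congr 1
    exact LinearEquiv.symm_apply_apply _ ξ
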